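/- \textbf{Conventions.} A finite poset $P$ is identified with the following game: two players alternately choose a remaining point $x$ and remove all remaining points $y$ with $x\le y$; a player who cannot move loses. $P$ is an \emph{$\exists$-game} if the first player has a winning strategy. The poset of a finite digraph $G$ is the set of strongly connected components of $G$, ordered by $[u]\le[v]$ iff $v$ is reachable from $u$; the game of $G$ is the game of this poset. $\mathrm{Nim}_2(\mathrm{Explicit},\mathrm{AR})$ is the promise problem whose input is an arbitrary digraph $G$ (given by its adjacency matrix), with the promise that the poset of $G$ is a disjoint (parallel) union of at most two chains, and the question whether this poset is an $\exists$-game. An $\mathrm{AC}^0$ reduction is a many-one reduction computed by a uniform family of Boolean circuits of constant depth and polynomial size with unbounded fan-in AND and OR gates (and negated inputs); uniform means that the direct connection language of the circuits is first-order definable with arithmetic. A reduction to a promise problem produces only instances satisfying the promise. \textbf{Theorem (Thierauf, 2009).} $\mathrm{Nim}_2(\mathrm{Explicit},\mathrm{AR})$ is $\mathrm{NL}$-hard under $\mathrm{AC}^0$ reductions: every language in $\mathrm{NL}$ reduces to it by an $\mathrm{AC}^0$ reduction. Moreover, let $G$ be any finite digraph with vertices $s,t$, and let $H$ be the digraph that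 consists of two disjoint copies $G$, $G'$ of $G$ and the two additional edges $t\to s'$ and $t'\to s$. Then the poset of $H$ is an $\exists$-game if and only if $t$ is reachable from $s$ in $G$, and the map $(G,s,t)\mapsto H$ is computable in (uniform) $\mathrm{AC}^0$. -/

import Mathlib

/-! ### Poset games -/

open Classical in
/-- The position `S` (a finite set of remaining points of a poset) is a win for the player to move:
some point `x` of `S` can be played, which removes all `y` with `x ≤ y`, so that the remaining
position is lost for the other player. -/
noncomputable def IsWinning {P : Type*} [PartialOrder P] (S : Finset P) : Prop :=
  ∃ x : {x : P // x ∈ S}, ¬ IsWinning (S.filter fun y => ¬ (x : P) ≤ y)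
termination_by S.card
decreasing_by
  exact Finset.card_lt_card
    (Finset.filter_ssubset.2 ⟨x.1, x.2, fun h => h le_rfl⟩)

/-- A finite poset is an `∃`-game if the first player wins its poset game. -/
noncomputable def IsExistsGame (P : Type*) [PartialOrder P] [Finite P] : Prop :=
  IsWinning (Set.finite_univ (α := P)).toFinset

/-- `P` is a parallel (disjoint) union of at most `k` finite chains: the chains have sizes
`c 0, …, c (k - 1)`, some of which may be zero. -/
def IsNimPoset (k : ℕ) (P : Type*) [PartialOrder P] : Prop :=
  ∃ c : Fin k → ℕ, Nonempty (P ≃o Σ i, Fin (c i))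

/-! ### The poset of a digraph -/

/-- `t` is reachable from `s` along directed edges (by a path of length `≥ 0`). -/
def Digraph.Reaches {V : Type*} (G : Digraph V) (s t : V) : Prop :=
  Relation.ReflTransGen G.Adj s t

/-- The reachability preorder: `x ≤ y` iff `y` is reachable from `x`. -/
abbrev Digraph.reachPreorder {V : Type*} (G : Digraph V) : Preorder V where
  le := G.Reaches
  le_refl _ := Relation.ReflTransGen.refl
  le_trans _ _ _ := Relation.ReflTransGen.trans

/-- The strongly connected components of `G`. -/
def Digraph.StrongComponents {V : Type*} (G : Digraph V) : Type _ :=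
  @Antisymmetrization V G.reachPreorder.le
    (@instIsPreorderLe V G.reachPreorder)

/-- The strongly connected components, ordered by reachability. -/
noncomputable instance {V : Type*} (G : Digraph V) : PartialOrder G.StrongComponents :=
  @instPartialOrderAntisymmetrization V G.reachPreorder

instance {V : Type*} [Finite V] (G : Digraph V) : Finite G.StrongComponents :=
  Quotient.finite _

/-- Two disjoint copies of `G`, joined by the cross edges `t → s'` and `t' → s`. -/
def Digraph.crossedDouble {V : Type*} (G : Digraph V) (s t : V) : Digraph (V ⊕ V) where
  Adj
    | .inl a, .inl b => G.Adj a b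
    | .inr a, .inr b => G.Adj a b
    | .inl a, .inr b => a = t ∧ b = s
    | .inr a, .inl b => a = t ∧ b = s

/-! ### Promise problems over binary strings -/

/-- A promise problem: on inputs satisfying the promise, decide membership in `question`. -/
structure PromiseProblem where
  promise : Set (List Bool)
  question : Set (List Bool)

open Classical in
/-- The adjacency matrix of a digraph on `{0, …, N - 1}`, written row by row as a string of
length `N * N`. -/
noncomputable def encodeDigraph {N : ℕ} (G : Digraph (Fin N)) : List Bool :=
  List.ofFn fun p : Fin (N * N) => decide (G.Adj p.divNat p.modNat)

open Classical in
/-- An instance `(G, s, t)` of the reachability problem for digraphs as a string: the adjacency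
matrix of `G`, followed by the indicator vectors of `s` and of `t`. -/
noncomputable def encodeReachability {N : ℕ} (G : Digraph (Fin N)) (s t : Fin N) : List Bool :=
  encodeDigraph G ++ (List.ofFn fun i => decide (i = s)) ++ List.ofFn fun i => decide (i = t)

/-- `G.crossedDouble s t` on the vertex set `{0, …, 2 N - 1}`: the vertex `v` of the first copy is
`v`, and the vertex `v'` of the second copy is `N + v`. -/
def Digraph.crossedDoubleFin {N : ℕ} (G : Digraph (Fin N)) (s t : Fin N) :
    Digraph (Fin (N + N)) where
  Adj a b := (G.crossedDouble s t).Adj (finSumFinEquiv.symm a) (finSumFinEquiv.symm b)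

/-- `Nim_k(Explicit, AR)`. Input: a digraph. Promise: the poset given by the reachability relation
on its strongly connected components is a parallel union of at most `k` chains. Question: is this
poset an `∃`-game? -/
def nimExplicitAR (k : ℕ) : PromiseProblem where
  promise := {w | ∃ (N : ℕ) (G : Digraph (Fin N)),
    encodeDigraph G = w ∧ IsNimPoset k G.StrongComponents}
  question := {w | ∃ (N : ℕ) (G : Digraph (Fin N)),
    encodeDigraph G = w ∧ IsExistsGame G.StrongComponents}

/-! ### Nondeterministic logarithmic space -/

/-- Head movements. -/
inductive HeadMove
  | left | stay | right

/-- Symbols on the read-only input tape: the input bits between two end markers. -/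
inductive InputSymbol
  | leftEnd | bit (b : Bool) | rightEnd

/-- A nondeterministic Turing machine with state set `Q`, a two-way read-only input tape, and one
work tape, infinite to the right, over the alphabet `Γ`.
`trans q i a q' a' m m'` says that in state `q`, reading `i` on the input tape and `a` on the work
tape, the machine may go to state `q'`, write `a'`, and move the input head by `m` and the work
head by `m'`. -/
structure NTM (Q Γ : Type) where
  start : Q
  accept : Set Q
  blank : Γ
  trans : Q → InputSymbol → Γ → Q → Γ → HeadMove → HeadMove → Prop

/-- Configurations. Cell `0` of the input tape holds the left end marker. -/
structure NTM.Config (Q Γ : Type) where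
  state : Q
  inPos : ℕ
  work : ℕ → Γ
  workPos : ℕ

/-- The new head position; a left move from cell `0` has no effect. -/
def HeadMove.apply : HeadMove → ℕ → ℕ
  | .left, p => p - 1
  | .stay, p => p
  | .right, p => p + 1

/-- The symbol in cell `p` of the input tape holding the word `x`. -/
def inputSymbol (x : List Bool) : ℕ → InputSymbol
  | 0 => .leftEnd
  | p + 1 => match x[p]? with
    | some b => .bit b
    | none => .rightEnd

namespace NTM

variable {Q Γ : Type}

/-- The initial configuration. -/
def init (M : NTM Q Γ) : Config Q Γ where
  state := M.start
  inPos := 0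
  work := fun _ => M.blank
  workPos := 0

/-- One step on input `x`; the input head does not move beyond the right end marker. -/
def Step (M : NTM Q Γ) (x : List Bool) (c c' : Config Q Γ) : Prop :=
  ∃ (q' : Q) (a' : Γ) (m m' : HeadMove),
    M.trans c.state (inputSymbol x c.inPos) (c.work c.workPos) q' a' m m' ∧
    c' = { state := q'
           inPos := min (m.apply c.inPos) (x.length + 1)
           work := Function.update c.work c.workPos a'
           workPos := m'.apply c.workPos }

/-- `c` occurs in some computation on input `x`. -/
def Reachable (M : NTM Q Γ) (x : List Bool) (c : Config Q Γ) : Prop :=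
  Relation.ReflTransGen (M.Step x) M.init c

/-- Some computation on input `x` reaches an accepting state. -/
def Accepts (M : NTM Q Γ) (x : List Bool) : Prop :=
  ∃ c, M.Reachable x c ∧ c.state ∈ M.accept

/-- On inputs of length `n`, every computation stays within `O(log n)` cells of the work tape. -/
def IsLogSpace (M : NTM Q Γ) : Prop :=
  ∃ k : ℕ, ∀ (x : List Bool) (c : Config Q Γ),
    M.Reachable x c → c.workPos < k * (Nat.log 2 x.length + 1)

end NTM

/-- The class `NL` of languages decided by nondeterministic Turing machines in logarithmic space. -/
def ClassNL : Set (Set (List Bool)) :=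
  {L | ∃ (Q Γ : Type) (_ : Finite Q) (_ : Finite Γ) (M : NTM Q Γ),
    M.IsLogSpace ∧ ∀ x, x ∈ L ↔ M.Accepts x}

/-! ### `AC⁰` reductions -/

/-- Families (indexed by the input length `n`) of relations on numbers that are first-order
definable from `n`, the order, addition, multiplication and the bit predicate, with quantifiers
over polynomially bounded numbers (that is, over tuples of elements of `{0, …, n - 1}`). -/
inductive FODefinable : (k : ℕ) → (ℕ → (Fin k → ℕ) → Prop) → Prop
  | length {k : ℕ} (i : Fin k) : FODefinable k fun n v => v i = n
  | le {k : ℕ} (i j : Fin k) : FODefinable k fun _ v => v i ≤ v j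
  | add {k : ℕ} (i j l : Fin k) : FODefinable k fun _ v => v i + v j = v l
  | mul {k : ℕ} (i j l : Fin k) : FODefinable k fun _ v => v i * v j = v l
  | bit {k : ℕ} (i j : Fin k) : FODefinable k fun _ v => (v i).testBit (v j) = true
  | not {k : ℕ} {R : ℕ → (Fin k → ℕ) → Prop} :
      FODefinable k R → FODefinable k fun n v => ¬ R n v
  | and {k : ℕ} {R S : ℕ → (Fin k → ℕ) → Prop} :
      FODefinable k R → FODefinable k S → FODefinable k fun n v => R n v ∧ S n v
  | exists {k : ℕ} (c : ℕ) {R : ℕ → (Fin (k + 1) → ℕ) → Prop} :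
      FODefinable (k + 1) R →
        FODefinable k fun n v => ∃ a, a ≤ n ^ c + c ∧ R n (Fin.cons a v)

/-- Labels of the gates of a circuit: an input bit, a negated input bit, or an AND or OR gate of
unbounded fan-in. (An AND gate without predecessors is the constant true, an OR gate without
predecessors the constant false.) -/
inductive GateLabel
  | input (i : ℕ) | negInput (i : ℕ) | and | or

/-- A family of Boolean circuits, one for each input length `n`. The gates of the `n`-th circuit
are `0, …, size n - 1`, its output gates are, in this order, `0, …, outputs n - 1`, and
`wire n g h` says that `h` is a predecessor of (feeds into) `g`. -/
structure CircuitFamily where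
  size : ℕ → ℕ
  outputs : ℕ → ℕ
  label : ℕ → ℕ → GateLabel
  wire : ℕ → ℕ → ℕ → Prop
  outputs_le : ∀ n, outputs n ≤ size n
  input_lt : ∀ n g i, g < size n →
    (label n g = .input i ∨ label n g = .negInput i) → i < n

namespace CircuitFamily

/-- The number of gates is polynomially bounded in the input length. -/
def IsPolySize (C : CircuitFamily) : Prop :=
  ∃ k : ℕ, ∀ n, C.size n ≤ n ^ k + k

/-- The circuits are acyclic and their depth is bounded by a constant. -/
def IsConstDepth (C : CircuitFamily) : Prop :=
  ∃ d : ℕ, ∀ n, ∃ rank : ℕ → ℕ,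
    (∀ g < C.size n, rank g ≤ d) ∧
    ∀ g < C.size n, ∀ h < C.size n, C.wire n g h → rank h < rank g

/-- Uniformity: the structure of the `n`-th circuit (its direct connection language) is
first-order definable. -/
structure IsUniform (C : CircuitFamily) : Prop where
  size : FODefinable 1 fun n v => v 0 < C.size n
  outputs : FODefinable 1 fun n v => v 0 < C.outputs n
  input : FODefinable 2 fun n v => v 0 < C.size n ∧ C.label n (v 0) = .input (v 1)
  negInput : FODefinable 2 fun n v => v 0 < C.size n ∧ C.label n (v 0) = .negInput (v 1)
  and : FODefinable 1 fun n v => v 0 < C.size n ∧ C.label n (v 0) = .and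
  or : FODefinable 1 fun n v => v 0 < C.size n ∧ C.label n (v 0) = .or
  wire : FODefinable 2 fun n v =>
    v 0 < C.size n ∧ v 1 < C.size n ∧ C.wire n (v 0) (v 1)

/-- `val` assigns to every gate its truth value on input `x`. (For an acyclic circuit there is
exactly one such assignment on the gates.) -/
def IsValuation (C : CircuitFamily) (x : List Bool) (val : ℕ → Prop) : Prop :=
  ∀ g < C.size x.length,
    (val g ↔ match C.label x.length g with
      | .input i => x[i]? = some true
      | .negInput i => x[i]? = some false
      | .and => ∀ h < C.size x.length, C.wire x.length g h → val h
      | .or => ∃ h < C.size x.length, C.wire x.length g h ∧ val h)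

/-- The circuits compute the function `f` on binary strings. -/
def Computes (C : CircuitFamily) (f : List Bool → List Bool) : Prop :=
  ∀ x, (f x).length = C.outputs x.length ∧
    ∃ val, C.IsValuation x val ∧
      ∀ (i : ℕ) (hi : i < (f x).length), (f x)[i] = true ↔ val i

end CircuitFamily

/-- `f` is computable in uniform `AC⁰`: by a uniform family of circuits of constant depth and
polynomial size with AND and OR gates of unbounded fan-in. -/
def AC0Computable (f : List Bool → List Bool) : Prop :=
  ∃ C : CircuitFamily, C.IsPolySize ∧ C.IsConstDepth ∧ C.IsUniform ∧ C.Computes f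

/-- The language `L` reduces to the promise problem `A` by an `AC⁰` many-one reduction, which
produces only instances that satisfy the promise. -/
def AC0Reduces (L : Set (List Bool)) (A : PromiseProblem) : Prop :=
  ∃ f, AC0Computable f ∧ ∀ x, f x ∈ A.promise ∧ (x ∈ L ↔ f x ∈ A.question)

/-- `A` is `NL`-hard under `AC⁰` reductions. -/
def IsNLHard (A : PromiseProblem) : Prop :=
  ∀ L ∈ ClassNL, AC0Reduces L A

/-! ### Winning positions of poset games -/

/-! Games. A position with an order automorphism that is an involution and moves every point to one
not above it is lost for the player to move: the opponent mirrors (`not_isWinning_of_involution`).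
In the crossed double, exchanging the copies induces such an automorphism `σ` of the poset. A
component `x ≤ σ x` exists only if `t` is reachable from `s`, and then every such `x` lies above the
component of `t`, which `σ` fixes. So without a path from `s` to `t` the second player mirrors; with
one, the first player plays the component of `t` and mirrors from then on. Mirroring also settles
the chain lengths `2, 2` (lost), and `1, 2` (won by playing the top of the longer chain).

Hardness. The crossed double need not be a union of chains, so it does not give a reduction that
respects the promise. The reduction used here turns the inductive counting of Immerman and
Szelepcsényényi into a proof system in which every inference has one premise, so that derivability
is reachability in a digraph. A `CountState` is a conjunction of bounded claims about the levels
`ReachIn s E i`: exact sizes, lower bounds on the members with or without an edge to a given vertex,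
one membership, and one stored claim kept while the others are rebuilt. Every state derives every
true state (`derives_of_valid`), by counting level after level. Every false state derives a
contradictory one (`exists_derives_bot`): a false claim is stored and then confronted with a derived
true one. A contradictory state derives everything. If `t` is unreachable, inferences preserve
truth, and the strong components are exactly the false and the true states, a chain of length two.
If `t` is reachable, the membership claim can arrive at `t`, which counts as contradictory, and all
states form one component. A separate chain of length two makes the game lost in the first case and
won in the second (`digraph_spec`).

Complexity. The counted graph is the configuration graph of a logspace machine, coded by numbers of
polynomial size. One inference consults only edges that leave one configuration, hence only one
input bit (`CountState.edge_congr`). So each entry of the output matrix is a disjunction of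
definable literals and constants (`AC0Computable.of_adj_inputBit`), and one level of gates suffices.
Uniformity follows from a calculus of definable relations and functions on polynomially bounded
numbers (`FODef`, `FOFun`). -/

open Classical in
theorem isWinning_iff {P : Type*} [PartialOrder P] {S : Finset P} :
    IsWinning S ↔ ∃ x ∈ S, ¬ IsWinning (S.filter fun y => ¬ x ≤ y) := by
  rw [IsWinning]
  exact ⟨fun ⟨x, h⟩ => ⟨x.1, x.2, h⟩, fun ⟨x, hx, h⟩ => ⟨⟨x, hx⟩, h⟩⟩

/-- The second player wins by mirroring along an involution that moves every point to an
incomparable one. -/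
theorem not_isWinning_of_involution {P : Type*} [PartialOrder P] (σ : P → P) (S : Finset P)
    (hmem : ∀ x ∈ S, σ x ∈ S) (hinv : ∀ x ∈ S, σ (σ x) = x)
    (hmono : ∀ x ∈ S, ∀ y ∈ S, x ≤ y → σ x ≤ σ y) (hinc : ∀ x ∈ S, ¬ x ≤ σ x) :
    ¬ IsWinning S := by
  classical
  induction hn : S.card using Nat.strong_induction_on generalizing S with
  | _ n ih =>
    rw [isWinning_iff]
    rintro ⟨x, hx, hlose⟩
    apply hlose
    rw [isWinning_iff]
    -- The answer `σ x` is still available because `x ≤ σ x` fails. After both moves the rest is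
    -- again closed under `σ`, and smaller.
    refine ⟨σ x, by simp [hmem x hx, hinc x hx], ?_⟩
    have hsub : ∀ y, y ∈ (S.filter fun y => ¬ x ≤ y).filter (fun y => ¬ σ x ≤ y) ↔
        y ∈ S ∧ ¬ x ≤ y ∧ ¬ σ x ≤ y := by
      intro y; simp [and_assoc]
    refine ih _ ?_ _ ?_ ?_ ?_ ?_ rfl
    · rw [← hn]
      apply Finset.card_lt_card
      refine ⟨fun y hy => ((hsub y).1 hy).1, fun h => ?_⟩
      exact ((hsub x).1 (h hx)).2.1 le_rfl
    · intro y hy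
      rw [hsub] at hy ⊢
      obtain ⟨hy, h1, h2⟩ := hy
      refine ⟨hmem y hy, fun h => h2 ?_, fun h => h1 ?_⟩
      · simpa [hinv y hy] using hmono _ hx _ (hmem y hy) h
      · simpa [hinv y hy, hinv x hx] using hmono _ (hmem x hx) _ (hmem y hy) h
    · intro y hy
      exact hinv y ((hsub y).1 hy).1
    · intro y hy z hz
      exact hmono y ((hsub y).1 hy).1 z ((hsub z).1 hz).1
    · intro y hy
      exact hinc y ((hsub y).1 hy).1

theorem isWinning_map_orderIso {P Q : Type*} [PartialOrder P] [PartialOrder Q] (e : P ≃o Q)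
    (S : Finset P) : IsWinning (S.map e.toEquiv.toEmbedding) ↔ IsWinning S := by
  classical
  induction hn : S.card using Nat.strong_induction_on generalizing S with
  | _ n ih =>
    rw [isWinning_iff, isWinning_iff]
    have key : ∀ x ∈ S, (IsWinning ((S.map e.toEquiv.toEmbedding).filter fun y => ¬ e x ≤ y) ↔
        IsWinning (S.filter fun y => ¬ x ≤ y)) := by
      intro x hx
      rw [← ih _ _ _ rfl]
      · congr! 1
        ext y
        simp only [Finset.mem_filter, Finset.mem_map, Equiv.coe_toEmbedding]
        constructor
        · rintro ⟨⟨z, hz, rfl⟩, h⟩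
          exact ⟨z, ⟨hz, fun h' => h (e.monotone h')⟩, rfl⟩
        · rintro ⟨z, ⟨hz, h⟩, rfl⟩
          exact ⟨⟨z, hz, rfl⟩, fun h' => h (e.le_iff_le.1 h')⟩
      · rw [← hn]
        exact Finset.card_lt_card (Finset.filter_ssubset.2 ⟨x, hx, fun h => h le_rfl⟩)
    constructor
    · rintro ⟨y, hy, h⟩
      obtain ⟨x, hx, rfl⟩ := Finset.mem_map.1 hy
      exact ⟨x, hx, fun h' => h ((key x hx).2 h')⟩
    · rintro ⟨x, hx, h⟩
      exact ⟨e x, Finset.mem_map.2 ⟨x, hx, rfl⟩, fun h' => h ((key x hx).1 h')⟩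

theorem isExistsGame_congr {P Q : Type*} [PartialOrder P] [PartialOrder Q] [Finite P] [Finite Q]
    (e : P ≃o Q) : IsExistsGame P ↔ IsExistsGame Q := by
  rw [IsExistsGame, IsExistsGame, ← isWinning_map_orderIso e]
  congr! 1
  ext y
  simp only [Finset.mem_map, Equiv.coe_toEmbedding, Set.Finite.mem_toFinset, Set.mem_univ,
    true_and, iff_true]
  exact ⟨e.symm y, e.apply_symm_apply y⟩

/-! ### Two chains -/

theorem not_isExistsGame_two_two : ¬ IsExistsGame (Σ i, Fin ((![2, 2] : Fin 2 → ℕ) i)) := by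
  refine not_isWinning_of_involution
    (fun x => match x with | ⟨0, a⟩ => ⟨1, a⟩ | ⟨1, a⟩ => ⟨0, a⟩) _ ?_ ?_ ?_ ?_
  · simp
  · rintro ⟨i, a⟩ -
    fin_cases i <;> rfl
  · rintro ⟨i, a⟩ - ⟨j, b⟩ - h
    obtain ⟨_, a, b, h⟩ := h
    fin_cases i <;> exact Sigma.LE.fiber _ _ _ h
  · rintro ⟨i, a⟩ - h
    rw [Sigma.le_def] at h
    obtain ⟨h, -⟩ := h
    fin_cases i <;> simp at h

theorem isExistsGame_one_two : IsExistsGame (Σ i, Fin ((![1, 2] : Fin 2 → ℕ) i)) := by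
  classical
  rw [IsExistsGame, isWinning_iff]
  -- The top of the longer chain is played, which leaves two single points to be exchanged by
  -- mirroring.
  refine ⟨⟨1, (1 : Fin 2)⟩, by simp, ?_⟩
  refine not_isWinning_of_involution
    (fun x => match x with | ⟨0, _⟩ => ⟨1, (0 : Fin 2)⟩ | ⟨1, _⟩ => ⟨0, (0 : Fin 1)⟩) _ ?_ ?_ ?_ ?_
  · rintro ⟨i, a⟩ -
    fin_cases i
    · simp [Sigma.le_def]
    · simp [Sigma.le_def]
  · rintro ⟨i, a⟩ h
    fin_cases i
    · change Fin 1 at a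
      have : a = 0 := Subsingleton.elim _ _
      subst this; rfl
    · change Fin 2 at a
      fin_cases a
      · rfl
      · simp at h
  · rintro ⟨i, a⟩ - ⟨j, b⟩ - h
    obtain ⟨_, a, b, h⟩ := h
    fin_cases i <;> exact le_rfl
  · rintro ⟨i, a⟩ - h
    rw [Sigma.le_def] at h
    obtain ⟨h, -⟩ := h
    fin_cases i <;> simp at h

/-! ### The poset of a digraph -/

namespace Digraph

variable {V : Type*} (G : Digraph V)

/-- The strong component of a vertex. -/
def component (v : V) : G.StrongComponents :=
  @toAntisymmetrization V G.reachPreorder.le (@instIsPreorderLe V G.reachPreorder) v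

theorem component_le_component {u v : V} : G.component u ≤ G.component v ↔ G.Reaches u v :=
  Iff.rfl

theorem component_surjective : Function.Surjective G.component := fun x =>
  Quotient.inductionOn' x fun v => ⟨v, rfl⟩

/-- The poset of `G` is `P` if reachability is the pullback of the order of `P` along a
surjection. -/
theorem nonempty_orderIso_of_reaches {P : Type*} [PartialOrder P] (φ : V → P)
    (hφ : Function.Surjective φ) (h : ∀ u v, G.Reaches u v ↔ φ u ≤ φ v) :
    Nonempty (G.StrongComponents ≃o P) := by
  choose r hr using G.component_surjective
  choose t ht using hφ
  have key : ∀ u v, G.component u ≤ G.component v ↔ φ u ≤ φ v := fun u v =>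
    (G.component_le_component).trans (h u v)
  have hm : ∀ u v, φ u = φ v → G.component u = G.component v := fun u v e =>
    le_antisymm ((key u v).2 e.le) ((key v u).2 e.ge)
  have hm' : ∀ u v, G.component u = G.component v → φ u = φ v := fun u v e =>
    le_antisymm ((key u v).1 e.le) ((key v u).1 e.ge)
  refine ⟨⟨⟨fun x => φ (r x), fun p => G.component (t p), fun x => ?_, fun p => ?_⟩, ?_⟩⟩
  · exact (hm _ _ (ht _)).trans (hr x)
  · exact (hm' _ _ (hr _)).trans (ht p)
  · intro x y
    change φ (r x) ≤ φ (r y) ↔ x ≤ y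
    rw [← key, hr, hr]

/-! ### Paths in the crossed double -/

/-- The swap of the two copies in the crossed double. -/
theorem Reaches.crossedDouble_swap {G : Digraph V} {s t : V} {x y : V ⊕ V}
    (h : (G.crossedDouble s t).Reaches x y) :
    (G.crossedDouble s t).Reaches x.swap y.swap := by
  refine Relation.ReflTransGen.lift Sum.swap ?_ _ _ h
  rintro (a | a) (b | b) h <;> exact h

theorem Reaches.crossedDouble_inl {G : Digraph V} {s t u v : V} (h : G.Reaches u v) :
    (G.crossedDouble s t).Reaches (.inl u) (.inl v) :=
  Relation.ReflTransGen.lift (p := (G.crossedDouble s t).Adj) Sum.inl (fun _ _ h => h) _ _ h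

/-- A path in the crossed double that starts in the first copy stays there, or meets `t` and `s'`
and stays in the second copy from then on, or shows that `t` is reachable from `s`. -/
theorem Reaches.of_crossedDouble_inl {G : Digraph V} {s t : V} {u : V} {y : V ⊕ V}
    (h : (G.crossedDouble s t).Reaches (.inl u) y) :
    (∃ v, y = .inl v ∧ G.Reaches u v) ∨
    (G.Reaches u t ∧ ∃ v, y = .inr v ∧ G.Reaches s v) ∨
    (G.Reaches s t ∧ (G.crossedDouble s t).Reaches (.inl t) y) := by
  induction h with
  | refl => exact .inl ⟨u, rfl, .refl⟩
  | @tail b c _ hbc ih =>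
    rcases ih with ⟨v, rfl, hv⟩ | ⟨hu, v, rfl, hv⟩ | ⟨h1, h2⟩
    · rcases c with c | c
      · exact .inl ⟨c, rfl, hv.tail hbc⟩
      · obtain ⟨rfl, rfl⟩ := hbc
        exact .inr (.inl ⟨hv, _, rfl, .refl⟩)
    · rcases c with c | c
      -- The path returns to the first copy by `t' → s`, so its stretch in the second copy leads
      -- from `s'` to `t'`. This gives a path from `s` to `t` in `G`, and `t → s' ⇝ t' → s` in the
      -- double.
      · obtain ⟨rfl, rfl⟩ := hbc
        have h1 : (G.crossedDouble c v).Adj (.inl v) (.inr c) := ⟨rfl, rfl⟩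
        have h2 : (G.crossedDouble c v).Adj (.inr v) (.inl c) := ⟨rfl, rfl⟩
        exact .inr (.inr ⟨hv, .tail (.head h1 hv.crossedDouble_inl.crossedDouble_swap) h2⟩)
      · exact .inr (.inl ⟨hu, c, rfl, hv.tail hbc⟩)
    · exact .inr (.inr ⟨h1, h2.tail hbc⟩)

theorem Reaches.crossedDouble_inl_inr {G : Digraph V} {s t v : V} (h : G.Reaches s v) :
    (G.crossedDouble s t).Reaches (.inl t) (.inr v) := by
  have h1 : (G.crossedDouble s t).Adj (.inl t) (.inr s) := ⟨rfl, rfl⟩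
  exact .head h1 h.crossedDouble_inl.crossedDouble_swap

/-- A path from `u` to `u'` that crosses once gives `u ⇝ t` and `s ⇝ u` in `G`, hence `s ⇝ t`; the
edge `t → s'` then leads on to `u'`. The components that obstruct mirroring therefore all lie above
that of `t`. -/
theorem Reaches.of_crossedDouble_swap {G : Digraph V} {s t : V} {x : V ⊕ V}
    (h : (G.crossedDouble s t).Reaches x x.swap) :
    G.Reaches s t ∧ (G.crossedDouble s t).Reaches (.inl t) x := by
  have main : ∀ u, (G.crossedDouble s t).Reaches (.inl u) (.inr u) →
      G.Reaches s t ∧ (G.crossedDouble s t).Reaches (.inl t) (.inr u) := by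
    intro u hu
    rcases hu.of_crossedDouble_inl with ⟨v, hv, -⟩ | ⟨h1, v, hv, h2⟩ | h
    · cases hv
    · cases hv
      exact ⟨h2.trans h1, h2.crossedDouble_inl_inr⟩
    · exact h
  rcases x with u | u
  · obtain ⟨h1, h2⟩ := main u h
    exact ⟨h1, h1.crossedDouble_inl_inr.trans h2.crossedDouble_swap⟩
  · exact main u h.crossedDouble_swap

theorem isExistsGame_crossedDouble [Finite V] (s t : V) :
    IsExistsGame (G.crossedDouble s t).StrongComponents ↔ G.Reaches s t := by
  classical
  set H := G.crossedDouble s t with hH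
  choose r hr using H.component_surjective
  let σ : H.StrongComponents → H.StrongComponents := fun x => H.component (r x).swap
  have hmono : ∀ u v, H.component u ≤ H.component v →
      H.component u.swap ≤ H.component v.swap := fun u v h => Reaches.crossedDouble_swap h
  have hσ : ∀ v, σ (H.component v) = H.component v.swap := fun v =>
    le_antisymm (hmono _ _ (hr _).le) (hmono _ _ (hr _).ge)
  have hinv : ∀ x, σ (σ x) = x := fun x => by
    change σ (H.component (r x).swap) = x
    rw [hσ, Sum.swap_swap, hr]
  have hle : ∀ x y, x ≤ y → σ x ≤ σ y := fun x y h => hmono _ _ (by rwa [hr, hr])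
  have hinc : ∀ x, x ≤ σ x → G.Reaches s t ∧ H.component (.inl t) ≤ x := by
    intro x h
    obtain ⟨v, rfl⟩ := H.component_surjective x
    rw [hσ, component_le_component] at h
    exact h.of_crossedDouble_swap
  by_cases hst : G.Reaches s t
  · refine iff_of_true ?_ hst
    -- The vertices `t` and `t'` reach each other by `t → s' ⇝ t'` and its mirror image. Hence
    -- removing everything above the component of `t` leaves a position closed under `σ`.
    have hfix : σ (H.component (.inl t)) = H.component (.inl t) := by
      rw [hσ]
      have h1 := hst.crossedDouble_inl_inr (t := t)
      exact le_antisymm h1.crossedDouble_swap h1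
    rw [IsExistsGame, isWinning_iff]
    refine ⟨H.component (.inl t), by simp,
      not_isWinning_of_involution σ _ ?_ (fun x _ => hinv x) (fun x _ y _ => hle x y) ?_⟩
    · intro x hx
      simp only [Finset.mem_filter, Set.Finite.mem_toFinset, Set.mem_univ, true_and] at hx ⊢
      intro h
      apply hx
      simpa [hinv, hfix] using hle _ _ h
    · intro x hx h
      exact (Finset.mem_filter.1 hx).2 (hinc x h).2
  · exact iff_of_false (not_isWinning_of_involution σ _ (by simp) (fun x _ => hinv x)
      (fun x _ y _ => hle x y) fun x _ h => hst (hinc x h).1) hst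

end Digraph

/-! ### Polynomial bounds -/

theorem pow_add_mono {c d : ℕ} (h : c ≤ d) (n : ℕ) : n ^ c + c ≤ n ^ d + d := by
  rcases Nat.eq_zero_or_pos n with rfl | hn
  · rcases Nat.eq_zero_or_pos c with rfl | hc
    · rcases Nat.eq_zero_or_pos d with rfl | hd
      · exact le_rfl
      · simp [hd.ne']; omega
    · simp [hc.ne', (hc.trans_le h).ne', h]
  · exact Nat.add_le_add (Nat.pow_le_pow_right hn h) h

theorem exists_pow_add_mul_le (a b : ℕ) : ∃ d, ∀ n, (n ^ a + a) * (n ^ b + b) ≤ n ^ d + d := by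
  -- The first summand bounds the product for `n ≤ 1`. The second is an exponent for `n ≥ 2`, where
  -- `a + 1 ≤ n ^ a` gives `n ^ a + a ≤ n ^ (2 * a)`.
  refine ⟨(1 + a) * (1 + b) + (2 * a + 2 * b), fun n => ?_⟩
  obtain hn | hn : n ≤ 1 ∨ 2 ≤ n := by omega
  · have h (a : ℕ) : n ^ a ≤ 1 := by simpa using Nat.pow_le_pow_left hn a
    calc (n ^ a + a) * (n ^ b + b) ≤ (1 + a) * (1 + b) :=
          Nat.mul_le_mul (Nat.add_le_add_right (h a) a) (Nat.add_le_add_right (h b) b)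
      _ ≤ _ := by omega
  · have h (a : ℕ) : n ^ a + a ≤ n ^ (2 * a) := by
      have h1 : a + 1 ≤ n ^ a := Nat.lt_pow_self hn
      calc n ^ a + a ≤ n ^ a * (a + 1) := by nlinarith
        _ ≤ n ^ a * n ^ a := Nat.mul_le_mul_left _ h1
        _ = n ^ (2 * a) := by rw [← pow_add, two_mul]
    calc (n ^ a + a) * (n ^ b + b) ≤ n ^ (2 * a) * n ^ (2 * b) := Nat.mul_le_mul (h a) (h b)
      _ = n ^ (2 * a + 2 * b) := by rw [← pow_add]
      _ ≤ n ^ ((1 + a) * (1 + b) + (2 * a + 2 * b)) := Nat.pow_le_pow_right (by omega) (by omega)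
      _ ≤ _ := Nat.le_add_right _ _

theorem exists_pow_add_add_le (a b : ℕ) : ∃ d, ∀ n, (n ^ a + a) + (n ^ b + b) ≤ n ^ d + d := by
  -- Raising the parameters by two makes both factors at least `2`, so that their product dominates
  -- their sum.
  obtain ⟨d, hd⟩ := exists_pow_add_mul_le (a + 2) (b + 2)
  refine ⟨d, fun n => le_trans ?_ (hd n)⟩
  have h1 := pow_add_mono (Nat.le_add_right a 2) n
  have h2 := pow_add_mono (Nat.le_add_right b 2) n
  have h3 : 2 ≤ n ^ (a + 2) + (a + 2) := by omega
  have h4 : 2 ≤ n ^ (b + 2) + (b + 2) := by omega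
  exact (Nat.add_le_add h1 h2).trans (Nat.add_le_mul h3 h4)

/-! ### First-order definability on polynomially bounded numbers -/

/-- `R` is first-order definable on polynomially bounded arguments. -/
def FODef {k : ℕ} (R : ℕ → (Fin k → ℕ) → Prop) : Prop :=
  ∀ c : ℕ, FODefinable k fun n v => (∀ i, v i ≤ n ^ c + c) ∧ R n v

/-- `f` has polynomially bounded values and a first-order definable graph. -/
structure FOFun {k : ℕ} (f : ℕ → (Fin k → ℕ) → ℕ) : Prop where
  bdd : ∀ c : ℕ, ∃ d : ℕ, ∀ n v, (∀ i, v i ≤ n ^ c + c) → f n v ≤ n ^ d + d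
  graph : FODef (k := k + 1) fun n w => w 0 = f n (Fin.tail w)

namespace FODefinable

theorem congr {k : ℕ} {R S : ℕ → (Fin k → ℕ) → Prop} (h : FODefinable k R)
    (hRS : ∀ n v, R n v ↔ S n v) : FODefinable k S := by
  have : R = S := by ext n v; exact hRS n v
  exact this ▸ h

theorem rename {k : ℕ} {R : ℕ → (Fin k → ℕ) → Prop} (h : FODefinable k R) {m : ℕ}
    (σ : Fin k → Fin m) : FODefinable m fun n v => R n fun i => v (σ i) := by
  induction h generalizing m with
  | length i => exact .length (σ i)
  | le i j => exact .le (σ i) (σ j)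
  | add i j l => exact .add (σ i) (σ j) (σ l)
  | mul i j l => exact .mul (σ i) (σ j) (σ l)
  | bit i j => exact .bit (σ i) (σ j)
  | not _ ih => exact (ih σ).not
  | and _ _ ih₁ ih₂ => exact (ih₁ σ).and (ih₂ σ)
  | _ =>
    rename_i k c R _ ih
    refine (FODefinable.exists c (ih (Fin.cons 0 fun i => (σ i).succ))).congr fun n v => ?_
    refine exists_congr fun a => and_congr_right fun _ => iff_of_eq (congrArg _ ?_)
    funext i
    refine Fin.cases ?_ (fun i => ?_) i <;> simp

end FODefinable

theorem FODefinable.le_pow_add {k : ℕ} (c : ℕ) (i : Fin k) :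
    FODefinable k fun n v => v i ≤ n ^ c + c :=
  (FODefinable.exists c ((FODefinable.le 0 i.succ).and (.le i.succ 0))).congr fun n v => by
    simp only [Fin.cons_zero, Fin.cons_succ]
    exact ⟨fun ⟨a, h, h1, h2⟩ => h2.trans h, fun h => ⟨v i, h, le_rfl, le_rfl⟩⟩

theorem FODefinable.true {k : ℕ} : FODefinable k fun _ _ => True :=
  (FODefinable.exists 0 (FODefinable.le 0 0)).congr fun n v => by
    simp only [le_refl, and_true, iff_true]
    exact ⟨0, Nat.zero_le _⟩

theorem FODefinable.forall_le_pow_add {k : ℕ} (c : ℕ) :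
    FODefinable k fun n v => ∀ i, v i ≤ n ^ c + c := by
  have h : ∀ S : Finset (Fin k), FODefinable k fun n v => ∀ i ∈ S, v i ≤ n ^ c + c := by
    intro S
    induction S using Finset.induction_on with
    | empty => exact FODefinable.true.congr fun n v => by simp
    | insert i S _ ih => exact ((FODefinable.le_pow_add c i).and ih).congr fun n v => by simp
  exact (h Finset.univ).congr fun n v => by simp

namespace FODef

variable {k : ℕ} {R S : ℕ → (Fin k → ℕ) → Prop}

theorem congr (h : FODef R) (hRS : ∀ n v, R n v ↔ S n v) : FODef S := fun c =>
  (h c).congr fun n v => by rw [hRS]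

theorem of_foDefinable (h : FODefinable k R) : FODef R := fun c =>
  (FODefinable.forall_le_pow_add c).and h

/-- A relation that implies a polynomial bound is definable without restriction. -/
theorem foDefinable (h : FODef R) (c : ℕ) (hc : ∀ n v, R n v → ∀ i, v i ≤ n ^ c + c) :
    FODefinable k R :=
  (h c).congr fun n v => ⟨fun h => h.2, fun h => ⟨hc n v h, h⟩⟩

theorem not (h : FODef R) : FODef fun n v => ¬ R n v := fun c =>
  ((FODefinable.forall_le_pow_add c).and (h c).not).congr fun n v => by tauto

theorem and (hR : FODef R) (hS : FODef S) : FODef fun n v => R n v ∧ S n v := fun c =>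
  ((hR c).and (hS c)).congr fun n v => by tauto

theorem or (hR : FODef R) (hS : FODef S) : FODef fun n v => R n v ∨ S n v :=
  (hR.not.and hS.not).not.congr fun n v => by tauto

theorem imp (hR : FODef R) (hS : FODef S) : FODef fun n v => R n v → S n v :=
  (hR.not.or hS).congr fun n v => by tauto

theorem iff (hR : FODef R) (hS : FODef S) : FODef fun n v => (R n v ↔ S n v) :=
  ((hR.imp hS).and (hS.imp hR)).congr fun n v => by tauto

theorem const (p : Prop) : FODef fun (_ : ℕ) (_ : Fin k → ℕ) => p := by
  by_cases h : p
  · exact (of_foDefinable FODefinable.true).congr fun _ _ => by simp [h]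
  · exact (of_foDefinable FODefinable.true).not.congr fun _ _ => by simp [h]

theorem rename (h : FODef R) {m : ℕ} (σ : Fin k → Fin m) :
    FODef fun n v => R n fun i => v (σ i) := fun c =>
  ((FODefinable.forall_le_pow_add c).and ((h c).rename σ)).congr fun n v => by
    constructor
    · exact fun h => ⟨h.1, h.2.2⟩
    · exact fun h => ⟨h.1, fun i => h.1 _, h.2⟩

/-- Formulas have only polynomially bounded quantifiers. On arguments bounded with exponent `c` all
witnesses are bounded with some exponent `d`, so the body is needed only for `max c d`. -/
theorem exists_of_bdd {R : ℕ → (Fin k → ℕ) → ℕ → Prop}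
    (h : FODef (k := k + 1) fun n w => R n (Fin.tail w) (w 0))
    (hb : ∀ c : ℕ, ∃ d : ℕ, ∀ n v, (∀ i, v i ≤ n ^ c + c) → ∀ a, R n v a → a ≤ n ^ d + d) :
    FODef fun n v => ∃ a, R n v a := by
  intro c
  obtain ⟨d, hd⟩ := hb c
  refine ((FODefinable.forall_le_pow_add c).and
    (FODefinable.exists d (h (max c d)))).congr fun n v => ?_
  simp only [Fin.tail_cons, Fin.cons_zero]
  constructor
  · rintro ⟨h1, a, -, -, h2⟩
    exact ⟨h1, a, h2⟩
  · rintro ⟨h1, a, h2⟩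
    have ha := hd n v h1 a h2
    refine ⟨h1, a, ha, fun i => ?_, h2⟩
    refine Fin.cases ?_ (fun i => ?_) i
    · exact ha.trans (pow_add_mono (le_max_right c d) n)
    · exact (h1 i).trans (pow_add_mono (le_max_left c d) n)

/-- Substitution of a function for the variable `0`. -/
theorem subst {R : ℕ → (Fin k → ℕ) → ℕ → Prop} {f : ℕ → (Fin k → ℕ) → ℕ} (hf : FOFun f)
    (h : FODef (k := k + 1) fun n w => R n (Fin.tail w) (w 0)) :
    FODef fun n v => R n v (f n v) := by
  refine (exists_of_bdd (R := fun n v a => a = f n v ∧ R n v a) (hf.graph.and h) ?_).congr ?_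
  · intro c
    obtain ⟨d, hd⟩ := hf.bdd c
    exact ⟨d, fun n v hv a ha => ha.1 ▸ hd n v hv⟩
  · simp

end FODef

namespace FOFun

variable {k : ℕ} {f g h : ℕ → (Fin k → ℕ) → ℕ}

theorem weaken (hf : FOFun f) : FOFun fun n (w : Fin (k + 1) → ℕ) => f n (Fin.tail w) where
  bdd c := (hf.bdd c).imp fun d hd n v hv => hd n _ fun i => hv _
  graph := (hf.graph.rename (Fin.cons 0 fun i => i.succ.succ)).congr fun n v => by
    simp only [Fin.cons_zero]
    congr! 1

theorem var (i : Fin k) : FOFun fun _ v => v i where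
  bdd c := ⟨c, fun _ _ hv => hv i⟩
  graph := (FODef.of_foDefinable ((FODefinable.le 0 i.succ).and (.le i.succ 0))).congr
    fun _ _ => le_antisymm_iff.symm

theorem length : FOFun fun n (_ : Fin k → ℕ) => n where
  bdd c := ⟨1, fun n v _ => by simp⟩
  graph := FODef.of_foDefinable (FODefinable.length 0)

end FOFun

namespace FODef

variable {k : ℕ} {f g h : ℕ → (Fin k → ℕ) → ℕ}

theorem subst₃ {R : ℕ → ℕ → ℕ → ℕ → Prop} (hR : FODef (k := 3) fun n v => R n (v 0) (v 1) (v 2))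
    (hf : FOFun f) (hg : FOFun g) (hh : FOFun h) :
    FODef fun n v => R n (f n v) (g n v) (h n v) := by
  refine subst (R := fun n v a => R n a (g n v) (h n v)) hf ?_
  refine subst (R := fun n v a => R n (v 0) a (h n (Fin.tail v))) hg.weaken ?_
  refine subst (R := fun n v a => R n (v 1) (v 0) a) hh.weaken.weaken ?_
  -- Each substitution puts its new variable in front, so the three values now stand in reverse
  -- order.
  exact hR.rename ![2, 1, 0]

theorem le (hf : FOFun f) (hg : FOFun g) : FODef fun n v => f n v ≤ g n v :=
  subst₃ (R := fun _ a b _ => a ≤ b) (of_foDefinable (.le 0 1)) hf hg hg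

theorem eq (hf : FOFun f) (hg : FOFun g) : FODef fun n v => f n v = g n v :=
  ((le hf hg).and (le hg hf)).congr fun _ _ => le_antisymm_iff.symm

end FODef

namespace FOFun

variable {k : ℕ} {f g h : ℕ → (Fin k → ℕ) → ℕ}

theorem add (hf : FOFun f) (hg : FOFun g) : FOFun fun n v => f n v + g n v where
  bdd c := by
    obtain ⟨a, ha⟩ := hf.bdd c
    obtain ⟨b, hb⟩ := hg.bdd c
    obtain ⟨d, hd⟩ := exists_pow_add_add_le a b
    exact ⟨d, fun n v hv => (Nat.add_le_add (ha n v hv) (hb n v hv)).trans (hd n)⟩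
  graph := (FODef.subst₃ (R := fun _ a b c => a + b = c)
    (FODef.of_foDefinable (.add 0 1 2)) hf.weaken hg.weaken (var 0)).congr fun _ _ => eq_comm

theorem mul (hf : FOFun f) (hg : FOFun g) : FOFun fun n v => f n v * g n v where
  bdd c := by
    obtain ⟨a, ha⟩ := hf.bdd c
    obtain ⟨b, hb⟩ := hg.bdd c
    obtain ⟨d, hd⟩ := exists_pow_add_mul_le a b
    exact ⟨d, fun n v hv => (Nat.mul_le_mul (ha n v hv) (hb n v hv)).trans (hd n)⟩
  graph := (FODef.subst₃ (R := fun _ a b c => a * b = c)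
    (FODef.of_foDefinable (.mul 0 1 2)) hf.weaken hg.weaken (var 0)).congr fun _ _ => eq_comm

theorem zero : FOFun fun _ (_ : Fin k → ℕ) => 0 where
  bdd _ := ⟨0, fun n v _ => by simp⟩
  graph := (FODef.of_foDefinable (.add 0 0 0)).congr fun n v => by omega

theorem one : FOFun fun _ (_ : Fin k → ℕ) => 1 where
  bdd _ := ⟨1, fun n v _ => by simp⟩
  -- The language has no constants; `1` is the nonzero solution of `a * a = a`.
  graph := ((FODef.of_foDefinable (.mul 0 0 0)).and (FODef.eq (var 0) zero).not).congr
    fun n v => by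
      constructor
      · rintro ⟨h1, h2⟩
        exact Nat.eq_of_mul_eq_mul_left (Nat.pos_of_ne_zero h2) (h1.trans (mul_one _).symm)
      · intro h; simp [h]

theorem const (c : ℕ) : FOFun fun _ (_ : Fin k → ℕ) => c := by
  induction c with
  | zero => exact zero
  | succ c ih => exact ih.add one

theorem pow (hf : FOFun f) (e : ℕ) : FOFun fun n v => f n v ^ e := by
  induction e with
  | zero => exact one
  | succ e ih => simpa only [pow_succ] using ih.mul hf

theorem of_le (hb : ∀ n v, f n v ≤ g n v) (hg : FOFun g)
    (h : FODef (k := k + 1) fun n w => w 0 = f n (Fin.tail w)) : FOFun f where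
  bdd c := (hg.bdd c).imp fun _ hd n v hv => (hb n v).trans (hd n v hv)
  graph := h

end FOFun

namespace FODef

variable {k : ℕ} {f g h : ℕ → (Fin k → ℕ) → ℕ}

theorem lt (hf : FOFun f) (hg : FOFun g) : FODef fun n v => f n v < g n v :=
  (le (hf.add FOFun.one) hg)

theorem ne (hf : FOFun f) (hg : FOFun g) : FODef fun n v => f n v ≠ g n v := (eq hf hg).not

theorem testBit (hf : FOFun f) (hg : FOFun g) : FODef fun n v => (f n v).testBit (g n v) = true :=
  subst₃ (R := fun _ a b _ => a.testBit b = true) (of_foDefinable (.bit 0 1)) hf hg hg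

theorem exists_lt {R : ℕ → (Fin k → ℕ) → ℕ → Prop} (hf : FOFun f)
    (h : FODef (k := k + 1) fun n w => R n (Fin.tail w) (w 0)) :
    FODef fun n v => ∃ a < f n v, R n v a := by
  refine exists_of_bdd (R := fun n v a => a < f n v ∧ R n v a)
    ((lt (FOFun.var 0) hf.weaken).and h) fun c => ?_
  obtain ⟨d, hd⟩ := hf.bdd c
  exact ⟨d, fun n v hv a ha => ha.1.le.trans (hd n v hv)⟩

theorem forall_lt {R : ℕ → (Fin k → ℕ) → ℕ → Prop} (hf : FOFun f)
    (h : FODef (k := k + 1) fun n w => R n (Fin.tail w) (w 0)) :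
    FODef fun n v => ∀ a < f n v, R n v a :=
  (exists_lt (R := fun n v a => ¬ R n v a) hf h.not).not.congr fun n v => by
    push Not; rfl

theorem exists_finite {ι : Type*} [Finite ι] {R : ι → ℕ → (Fin k → ℕ) → Prop}
    (h : ∀ i, FODef (R i)) : FODef fun n v => ∃ i, R i n v := by
  classical
  have := Fintype.ofFinite ι
  have key : ∀ S : Finset ι, FODef fun n v => ∃ i ∈ S, R i n v := by
    intro S
    induction S using Finset.induction_on with
    | empty => exact (const False).congr fun n v => by simp
    | insert i S _ ih => exact ((h i).or ih).congr fun n v => by simp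
  exact (key Finset.univ).congr fun n v => by simp

theorem forall_finite {ι : Type*} [Finite ι] {R : ι → ℕ → (Fin k → ℕ) → Prop}
    (h : ∀ i, FODef (R i)) : FODef fun n v => ∀ i, R i n v :=
  (exists_finite fun i => (h i).not).not.congr fun n v => by simp

end FODef

namespace FOFun

variable {k : ℕ} {f g h : ℕ → (Fin k → ℕ) → ℕ}

theorem sub (hf : FOFun f) (hg : FOFun g) : FOFun fun n v => f n v - g n v :=
  of_le (fun _ _ => Nat.sub_le _ _) hf <|
    (((FODef.le hf.weaken hg.weaken).and (FODef.eq (var 0) zero)).or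
      ((FODef.le hg.weaken hf.weaken).and (FODef.eq ((var 0).add hg.weaken) hf.weaken))).congr
    fun n v => by omega

theorem div (hf : FOFun f) (hg : FOFun g) : FOFun fun n v => f n v / g n v :=
  of_le (fun _ _ => Nat.div_le_self _ _) hf <|
    -- Division by zero has the value `0` and needs its own disjunct.
    (((FODef.eq hg.weaken zero).and (FODef.eq (var 0) zero)).or
      ((FODef.lt zero hg.weaken).and ((FODef.le ((var 0).mul hg.weaken) hf.weaken).and
        (FODef.lt hf.weaken (((var 0).add one).mul hg.weaken))))).congr fun n v => by
    rcases Nat.eq_zero_or_pos (g n (Fin.tail v)) with h | h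
    · simp [h]
    · rw [eq_comm (a := v 0) (b := _ / _), Nat.div_eq_iff h]
      constructor
      · rintro (h1 | h1)
        · omega
        · refine ⟨by simpa using h1.2.1, ?_⟩
          have := h1.2.2
          rw [add_mul] at this
          omega
      · rintro ⟨h1, h2⟩
        refine .inr ⟨h, h1, ?_⟩
        rw [add_mul]
        omega

theorem mod (hf : FOFun f) (hg : FOFun g) : FOFun fun n v => f n v % g n v :=
  of_le (fun _ _ => Nat.mod_le _ _) hf <|
    (FODef.eq ((var 0).add (hg.weaken.mul (hf.div hg).weaken)) hf.weaken).congr fun n v => by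
      have := Nat.mod_add_div (f n (Fin.tail v)) (g n (Fin.tail v))
      omega

end FOFun

/-! ### Circuits of one level above the literals -/

namespace CircuitFamily

/-- A family of circuits with one level of gates, all labelled `l`, above the literals: the output
gate `g` is fed by the inputs `i` with `pos n g i`, the negated inputs `i` with `neg n g i`, and the
constant true if `top n g`. -/
def ofLiterals (l : GateLabel) (hl : l = .and ∨ l = .or) (m : ℕ → ℕ) (pos neg : ℕ → ℕ → ℕ → Prop)
    (top : ℕ → ℕ → Prop) : CircuitFamily where
  size n := m n + n + n + 1
  outputs := m
  label n g := if g < m n then l else if g < m n + n then .input (g - m n) else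
    if g < m n + n + n then .negInput (g - (m n + n)) else .and
  wire n g h := g < m n ∧ ((∃ i < n, h = m n + i ∧ pos n g i) ∨
    (∃ i < n, h = m n + n + i ∧ neg n g i) ∨ (h = m n + n + n ∧ top n g))
  outputs_le n := by omega
  input_lt n g i hg := by
    have h1 : ∀ i, l ≠ .input i := by rcases hl with rfl | rfl <;> simp
    have h2 : ∀ i, l ≠ .negInput i := by rcases hl with rfl | rfl <;> simp
    split_ifs <;> simp [h1, h2] <;> omega

section

variable {l : GateLabel} {hl : l = .and ∨ l = .or} {m : ℕ → ℕ} {pos neg : ℕ → ℕ → ℕ → Prop}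
  {top : ℕ → ℕ → Prop}

theorem label_ofLiterals (n g : ℕ) : (ofLiterals l hl m pos neg top).label n g =
    if g < m n then l else if g < m n + n then .input (g - m n) else
    if g < m n + n + n then .negInput (g - (m n + n)) else .and := rfl

theorem size_ofLiterals {n : ℕ} :
    (ofLiterals l hl m pos neg top).size n = m n + n + n + 1 := rfl

theorem isPolySize_ofLiterals (hm : ∀ {k}, FOFun (k := k) fun n _ => m n) :
    (ofLiterals l hl m pos neg top).IsPolySize := by
  obtain ⟨d, hd⟩ := (((hm.add FOFun.length).add FOFun.length).add FOFun.one).bdd (k := 0) 0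
  exact ⟨d, fun n => hd n Fin.elim0 fun i => i.elim0⟩

theorem isConstDepth_ofLiterals : (ofLiterals l hl m pos neg top).IsConstDepth := by
  refine ⟨1, fun n => ⟨fun g => if g < m n then 1 else 0, fun g _ => ?_, fun g _ h _ hw => ?_⟩⟩
  · dsimp only
    split_ifs <;> omega
  · obtain ⟨hg, ⟨i, -, rfl, -⟩ | ⟨i, -, rfl, -⟩ | ⟨rfl, -⟩⟩ := hw
    all_goals
      dsimp only
      rw [if_pos hg, if_neg (by omega)]
      exact Nat.zero_lt_one

/-- Every relation of the direct connection language bounds its arguments by the size of the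
circuit, which is polynomial. Hence definability on bounded arguments is definability outright, by
`FODef.foDefinable`. -/
theorem isUniform_ofLiterals (hm : ∀ {k}, FOFun (k := k) fun n _ => m n)
    (hpos : FODef (k := 2) fun n v => pos n (v 0) (v 1))
    (hneg : FODef (k := 2) fun n v => neg n (v 0) (v 1))
    (htop : FODef (k := 1) fun n v => top n (v 0)) :
    (ofLiterals l hl m pos neg top).IsUniform := by
  obtain ⟨d, hd⟩ := isPolySize_ofLiterals (l := l) (hl := hl) (pos := pos) (neg := neg)
    (top := top) hm
  have hd : ∀ n, m n + n + n + 1 ≤ n ^ d + d := hd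
  have h1 : ∀ i, l ≠ .input i := by rcases hl with rfl | rfl <;> simp
  have h2 : ∀ i, l ≠ .negInput i := by rcases hl with rfl | rfl <;> simp
  have hlen : ∀ {k}, FOFun (k := k) fun n _ => n := FOFun.length
  have hs : ∀ {k}, FOFun (k := k) fun n _ => m n + n + n + 1 :=
    ((hm.add hlen).add hlen).add .one
  have v0 : ∀ {k}, FOFun (k := k + 1) fun _ v => v 0 := FOFun.var 0
  have v1 : ∀ {k}, FOFun (k := k + 2) fun _ v => v 1 := FOFun.var 1
  constructor
  · refine FODef.foDefinable (FODef.lt v0 hs) d fun n v h => ?_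
    simpa [Fin.forall_fin_one] using h.le.trans (hd n)
  · refine FODef.foDefinable (FODef.lt v0 hm) d fun n v h => ?_
    have := hd n
    have h : v 0 < m n := h
    refine Fin.forall_fin_one.2 ?_; omega
  · refine ((FODef.lt v1 hlen).and (FODef.eq v0 (hm.add v1))).foDefinable d ?_ |>.congr ?_
    · rintro n v ⟨h, h'⟩
      have := hd n
      refine Fin.forall_fin_two.2 ⟨?_, ?_⟩ <;> omega
    · intro n v
      have hl := label_ofLiterals (l := l) (hl := hl) (m := m) (pos := pos) (neg := neg) (top := top) n (v 0)
      rw [hl, size_ofLiterals]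
      grind
  · refine ((FODef.lt v1 hlen).and (FODef.eq v0 ((hm.add hlen).add v1))).foDefinable d ?_
      |>.congr ?_
    · rintro n v ⟨h, h'⟩
      have := hd n
      refine Fin.forall_fin_two.2 ⟨?_, ?_⟩ <;> omega
    · intro n v
      have hl := label_ofLiterals (l := l) (hl := hl) (m := m) (pos := pos) (neg := neg) (top := top) n (v 0)
      rw [hl, size_ofLiterals]
      grind
  -- Besides the outputs, if `l` is AND, the last gate is an AND gate: the constant true, without
  -- predecessors.
  · refine (((FODef.const (l = .and)).and (FODef.lt v0 hm)).or
      (FODef.eq v0 ((hm.add hlen).add hlen))).foDefinable d ?_ |>.congr ?_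
    · intro n v h
      have := hd n
      have h : v 0 ≤ m n + n + n := by rcases h with ⟨_, h⟩ | h <;> omega
      refine Fin.forall_fin_one.2 ?_; omega
    · intro n v
      have hl := label_ofLiterals (l := l) (hl := hl) (m := m) (pos := pos) (neg := neg) (top := top) n (v 0)
      rw [hl, size_ofLiterals]
      grind
  · refine ((FODef.const (l = .or)).and (FODef.lt v0 hm)).foDefinable d ?_ |>.congr ?_
    · intro n v h
      have := hd n
      have h : v 0 < m n := h.2
      refine Fin.forall_fin_one.2 ?_; omega
    · intro n v
      have hl := label_ofLiterals (l := l) (hl := hl) (m := m) (pos := pos) (neg := neg) (top := top) n (v 0)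
      rw [hl, size_ofLiterals]
      grind
  · refine FODef.foDefinable (R := fun n v => v 0 < m n + n + n + 1 ∧ v 1 < m n + n + n + 1 ∧
      (v 0 < m n ∧ ((∃ i < n, v 1 = m n + i ∧ pos n (v 0) i) ∨
      (∃ i < n, v 1 = m n + n + i ∧ neg n (v 0) i) ∨ (v 1 = m n + n + n ∧ top n (v 0))))) ?_ d ?_
    · refine (FODef.lt v0 hs).and ((FODef.lt v1 hs).and ((FODef.lt v0 hm).and (.or ?_ (.or ?_ ?_))))
      · exact FODef.exists_lt (R := fun n v i => v 1 = m n + i ∧ pos n (v 0) i) hlen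
          ((FODef.eq (.var 2) (hm.add v0)).and (hpos.rename ![1, 0]))
      · exact FODef.exists_lt (R := fun n v i => v 1 = m n + n + i ∧ neg n (v 0) i) hlen
          ((FODef.eq (.var 2) ((hm.add hlen).add v0)).and (hneg.rename ![1, 0]))
      · exact (FODef.eq v1 ((hm.add hlen).add hlen)).and (htop.rename ![0])
    · rintro n v ⟨h, h', -⟩
      have := hd n
      refine Fin.forall_fin_two.2 ⟨?_, ?_⟩ <;> omega

/-- The value of gate `g` of a one-level circuit on input `x`, if `g` is not an output gate. -/
def literalValue (M : ℕ) (x : List Bool) (g : ℕ) : Prop :=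
  if g < M + x.length then x[g - M]? = some true else
    if g < M + x.length + x.length then x[g - (M + x.length)]? = some false else True

theorem literalValue_pos {M i : ℕ} {x : List Bool} (hi : i < x.length) :
    literalValue M x (M + i) ↔ x[i]? = some true := by
  rw [literalValue, if_pos (by omega), Nat.add_sub_cancel_left]

theorem literalValue_neg {M i : ℕ} {x : List Bool} (hi : i < x.length) :
    literalValue M x (M + x.length + i) ↔ x[i]? = some false := by
  rw [literalValue, if_neg (by omega), if_pos (by omega), Nat.add_sub_cancel_left]

theorem literalValue_top {M : ℕ} {x : List Bool} : literalValue M x (M + x.length + x.length) := by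
  rw [literalValue, if_neg (by omega), if_neg (by omega)]
  trivial

theorem wire_ofLiterals {n g h : ℕ} : (ofLiterals l hl m pos neg top).wire n g h ↔ g < m n ∧
    ((∃ i < n, h = m n + i ∧ pos n g i) ∨ (∃ i < n, h = m n + n + i ∧ neg n g i) ∨
      (h = m n + n + n ∧ top n g)) := Iff.rfl

theorem forall_wire_ofLiterals {x : List Bool} {g : ℕ} (hg : g < m x.length) :
    (∀ h < (ofLiterals l hl m pos neg top).size x.length,
      (ofLiterals l hl m pos neg top).wire x.length g h → literalValue (m x.length) x h) ↔
    (∀ i < x.length, pos x.length g i → x[i]? = some true) ∧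
      ∀ i < x.length, neg x.length g i → x[i]? = some false := by
  simp only [wire_ofLiterals, size_ofLiterals, hg, true_and]
  constructor
  · intro H
    refine ⟨fun i hi hp => ?_, fun i hi hp => ?_⟩
    · exact (literalValue_pos hi).1 (H _ (by omega) (.inl ⟨i, hi, rfl, hp⟩))
    · exact (literalValue_neg hi).1 (H _ (by omega) (.inr (.inl ⟨i, hi, rfl, hp⟩)))
  · rintro ⟨H1, H2⟩ h - (⟨i, hi, rfl, hp⟩ | ⟨i, hi, rfl, hp⟩ | ⟨rfl, -⟩)
    · exact (literalValue_pos hi).2 (H1 i hi hp)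
    · exact (literalValue_neg hi).2 (H2 i hi hp)
    · exact literalValue_top

theorem exists_wire_ofLiterals {x : List Bool} {g : ℕ} (hg : g < m x.length) :
    (∃ h < (ofLiterals l hl m pos neg top).size x.length,
      (ofLiterals l hl m pos neg top).wire x.length g h ∧ literalValue (m x.length) x h) ↔
    top x.length g ∨ (∃ i < x.length, pos x.length g i ∧ x[i]? = some true) ∨
      ∃ i < x.length, neg x.length g i ∧ x[i]? = some false := by
  simp only [wire_ofLiterals, size_ofLiterals, hg, true_and]
  constructor
  · rintro ⟨h, -, ⟨i, hi, rfl, hp⟩ | ⟨i, hi, rfl, hp⟩ | ⟨rfl, hp⟩, hv⟩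
    · exact .inr (.inl ⟨i, hi, hp, (literalValue_pos hi).1 hv⟩)
    · exact .inr (.inr ⟨i, hi, hp, (literalValue_neg hi).1 hv⟩)
    · exact .inl hp
  · rintro (hp | ⟨i, hi, hp, hv⟩ | ⟨i, hi, hp, hv⟩)
    · exact ⟨_, by omega, .inr (.inr ⟨rfl, hp⟩), literalValue_top⟩
    · exact ⟨m x.length + i, by omega, .inl ⟨i, hi, rfl, hp⟩, (literalValue_pos hi).2 hv⟩
    · exact ⟨m x.length + x.length + i, by omega, .inr (.inl ⟨i, hi, rfl, hp⟩),
        (literalValue_neg hi).2 hv⟩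

open Classical in
-- With a single level above the literals the valuation can be written down: wires lead only from
-- outputs to gates that are not outputs, so no recursion is needed.
theorem exists_isValuation_ofLiterals (x : List Bool) :
    ∃ val, (ofLiterals l hl m pos neg top).IsValuation x val ∧ ∀ g < m x.length,
      (val g ↔ if l = .and then ∀ h < (ofLiterals l hl m pos neg top).size x.length,
        (ofLiterals l hl m pos neg top).wire x.length g h → literalValue (m x.length) x h
      else ∃ h < (ofLiterals l hl m pos neg top).size x.length,
        (ofLiterals l hl m pos neg top).wire x.length g h ∧ literalValue (m x.length) x h) := by
  set C := ofLiterals l hl m pos neg top with hC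
  let val : ℕ → Prop := fun g => if g < m x.length then
    if l = .and then ∀ h < C.size x.length, C.wire x.length g h → literalValue (m x.length) x h
    else ∃ h < C.size x.length, C.wire x.length g h ∧ literalValue (m x.length) x h
    else literalValue (m x.length) x g
  have hval : ∀ g, m x.length ≤ g → val g = literalValue (m x.length) x g := fun g hg =>
    if_neg (by omega)
  refine ⟨val, fun g hg => ?_, fun g hg => by simp only [val, if_pos hg]⟩
  rw [hC, size_ofLiterals] at hg
  have hwire : ∀ h, C.wire x.length g h → g < m x.length ∧ m x.length ≤ h := by
    rintro h ⟨h1, ⟨i, -, rfl, -⟩ | ⟨i, -, rfl, -⟩ | ⟨rfl, -⟩⟩ <;> exact ⟨h1, by omega⟩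
  have hlab : C.label x.length g = _ := label_ofLiterals ..
  rw [hlab]
  by_cases h1 : g < m x.length
  · simp only [val, if_pos h1]
    rcases hl with rfl | rfl
    · simp only [if_true]
      refine forall₃_congr fun h _ hw => ?_
      rw [if_neg (by have := (hwire h hw).2; omega)]
    · simp only [reduceCtorEq, if_false]
      refine exists_congr fun h => and_congr_right fun _ => and_congr_right fun hw => ?_
      rw [if_neg (by have := (hwire h hw).2; omega)]
  · rw [hval g (by omega), literalValue]
    split_ifs
    · rfl
    · rfl
    · simp only [true_iff]
      exact fun h _ hw => absurd (hwire h hw).1 h1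

end

end CircuitFamily

section

variable {m : ℕ → ℕ} {pos neg : ℕ → ℕ → ℕ → Prop} {top : ℕ → ℕ → Prop} {f : List Bool → List Bool}

/-- A function whose output bits are conjunctions of definable sets of literals is in `AC⁰`. -/
theorem AC0Computable.of_forall_literals (hm : ∀ {k}, FOFun (k := k) fun n _ => m n)
    (hpos : FODef (k := 2) fun n v => pos n (v 0) (v 1))
    (hneg : FODef (k := 2) fun n v => neg n (v 0) (v 1))
    (hlen : ∀ x, (f x).length = m x.length)
    (hf : ∀ x g (hg : g < (f x).length), (f x)[g] = true ↔
      (∀ i < x.length, pos x.length g i → x[i]? = some true) ∧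
        ∀ i < x.length, neg x.length g i → x[i]? = some false) : AC0Computable f := by
  refine ⟨.ofLiterals .and (.inl rfl) m pos neg fun _ _ => False,
    CircuitFamily.isPolySize_ofLiterals hm, CircuitFamily.isConstDepth_ofLiterals,
    CircuitFamily.isUniform_ofLiterals hm hpos hneg (.const False), fun x => ⟨hlen x, ?_⟩⟩
  obtain ⟨val, h1, h2⟩ := CircuitFamily.exists_isValuation_ofLiterals (hl := .inl rfl) (m := m)
    (pos := pos) (neg := neg) (top := fun _ _ => False) x
  refine ⟨val, h1, fun g hg => ?_⟩
  have hg' : g < m x.length := hlen x ▸ hg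
  rw [hf, h2 g hg', if_pos rfl, CircuitFamily.forall_wire_ofLiterals hg']

/-- A function whose output bits are disjunctions of definable sets of literals is in `AC⁰`. -/
theorem AC0Computable.of_exists_literal (hm : ∀ {k}, FOFun (k := k) fun n _ => m n)
    (hpos : FODef (k := 2) fun n v => pos n (v 0) (v 1))
    (hneg : FODef (k := 2) fun n v => neg n (v 0) (v 1))
    (htop : FODef (k := 1) fun n v => top n (v 0))
    (hlen : ∀ x, (f x).length = m x.length)
    (hf : ∀ x g (hg : g < (f x).length), (f x)[g] = true ↔
      top x.length g ∨ (∃ i < x.length, pos x.length g i ∧ x[i]? = some true) ∨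
        ∃ i < x.length, neg x.length g i ∧ x[i]? = some false) : AC0Computable f := by
  refine ⟨.ofLiterals .or (.inr rfl) m pos neg top,
    CircuitFamily.isPolySize_ofLiterals hm, CircuitFamily.isConstDepth_ofLiterals,
    CircuitFamily.isUniform_ofLiterals hm hpos hneg htop, fun x => ⟨hlen x, ?_⟩⟩
  obtain ⟨val, h1, h2⟩ := CircuitFamily.exists_isValuation_ofLiterals (hl := .inr rfl) (m := m)
    (pos := pos) (neg := neg) (top := top) x
  refine ⟨val, h1, fun g hg => ?_⟩
  have hg' : g < m x.length := hlen x ▸ hg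
  rw [hf, h2 g hg', if_neg (by simp), CircuitFamily.exists_wire_ofLiterals hg']

end

/-! ### The adjacency matrix of the crossed double in `AC⁰` -/

theorem FOFun.sqrt {k : ℕ} {f : ℕ → (Fin k → ℕ) → ℕ} (hf : FOFun f) :
    FOFun fun n v => Nat.sqrt (f n v) :=
  of_le (fun _ _ => Nat.sqrt_le_self _) hf <|
    ((FODef.le ((var 0).mul (var 0)) hf.weaken).and
      (FODef.lt hf.weaken (((var 0).add one).mul ((var 0).add one)))).congr fun n v => by
    rw [Nat.eq_sqrt]

@[simp]
theorem length_encodeDigraph {N : ℕ} (G : Digraph (Fin N)) : (encodeDigraph G).length = N * N :=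
  List.length_ofFn

theorem getElem_encodeDigraph {N : ℕ} (G : Digraph (Fin N)) (z : ℕ)
    (hz : z < (encodeDigraph G).length) : (encodeDigraph G)[z] = true ↔
      ∃ (h1 : z / N < N) (h2 : z % N < N), G.Adj ⟨z / N, h1⟩ ⟨z % N, h2⟩ := by
  have hz' : z < N * N := by simpa using hz
  have hN : 0 < N := Nat.pos_of_ne_zero (by rintro rfl; omega)
  have h1 : z / N < N := Nat.div_lt_of_lt_mul hz'
  have h2 : z % N < N := Nat.mod_lt _ hN
  simp only [encodeDigraph, List.getElem_ofFn, decide_eq_true_eq]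
  exact ⟨fun h => ⟨h1, h2, h⟩, fun ⟨_, _, h⟩ => h⟩

theorem mul_add_lt_mul_self {N a b : ℕ} (ha : a < N) (hb : b < N) : a * N + b < N * N := by
  calc a * N + b < (a + 1) * N := by rw [add_mul]; omega
    _ ≤ N * N := Nat.mul_le_mul_right N ha

section

variable {N : ℕ} (G : Digraph (Fin N)) (s t : Fin N)

theorem length_encodeReachability : (encodeReachability G s t).length = N * N + N + N := by
  simp [encodeReachability, add_assoc]

theorem encodeReachability_adj (a b : Fin N) :
    (encodeReachability G s t)[(a : ℕ) * N + b]? = some true ↔ G.Adj a b := by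
  have h := mul_add_lt_mul_self a.2 b.2
  have h' : (a : ℕ) * N + b < (encodeDigraph G).length := by simpa using h
  rw [encodeReachability, List.append_assoc, List.getElem?_append_left h',
    List.getElem?_eq_getElem h', Option.some_inj, getElem_encodeDigraph]
  have h1 : ((a : ℕ) * N + b) / N = a := by
    rw [mul_comm, Nat.mul_add_div (by omega), Nat.div_eq_of_lt b.2, add_zero]
  have h2 : ((a : ℕ) * N + b) % N = b := by
    rw [Nat.mul_add_mod_self_right, Nat.mod_eq_of_lt b.2]
  simp only [h1, h2, Fin.eta, Fin.is_lt, exists_prop, true_and]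

theorem encodeReachability_source (a : Fin N) :
    (encodeReachability G s t)[N * N + a]? = some true ↔ a = s := by
  rw [encodeReachability, List.append_assoc, List.getElem?_append_right (by simp),
    List.getElem?_append_left (by simp)]
  simp

theorem encodeReachability_target (a : Fin N) :
    (encodeReachability G s t)[N * N + N + a]? = some true ↔ a = t := by
  rw [encodeReachability, List.getElem?_append_right (by simp)]
  simp

end

/-- The input bits whose conjunction is entry `z` of the adjacency matrix of the crossed double, on
inputs that encode a digraph on `N` vertices. -/
def CrossedDoubleLiteral (N z i : ℕ) : Prop :=
  (z / (N + N) < N ∧ z % (N + N) < N ∧ i = z / (N + N) * N + z % (N + N)) ∨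
  (N ≤ z / (N + N) ∧ N ≤ z % (N + N) ∧ i = (z / (N + N) - N) * N + (z % (N + N) - N)) ∨
  (z / (N + N) < N ∧ N ≤ z % (N + N) ∧
    (i = N * N + N + z / (N + N) ∨ i = N * N + (z % (N + N) - N))) ∨
  (N ≤ z / (N + N) ∧ z % (N + N) < N ∧
    (i = N * N + N + (z / (N + N) - N) ∨ i = N * N + z % (N + N)))

theorem foDef_crossedDoubleLiteral {k : ℕ} {N z i : ℕ → (Fin k → ℕ) → ℕ} (hN : FOFun N)
    (hz : FOFun z) (hi : FOFun i) :
    FODef fun n v => CrossedDoubleLiteral (N n v) (z n v) (i n v) := by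
  have hd := hz.div (hN.add hN)
  have hm := hz.mod (hN.add hN)
  have hNN := hN.mul hN
  exact ((FODef.lt hd hN).and ((FODef.lt hm hN).and (FODef.eq hi ((hd.mul hN).add hm)))).or
    (((FODef.le hN hd).and ((FODef.le hN hm).and
      (FODef.eq hi (((hd.sub hN).mul hN).add (hm.sub hN))))).or
    (((FODef.lt hd hN).and ((FODef.le hN hm).and ((FODef.eq hi ((hNN.add hN).add hd)).or
      (FODef.eq hi (hNN.add (hm.sub hN)))))).or
    ((FODef.le hN hd).and ((FODef.lt hm hN).and ((FODef.eq hi ((hNN.add hN).add (hd.sub hN))).or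
      (FODef.eq hi (hNN.add hm)))))))

theorem forall_crossedDoubleLiteral {N : ℕ} (G : Digraph (Fin N)) (s t : Fin N) (z : ℕ)
    (hz : z < (N + N) * (N + N)) :
    (∀ i < N * N + N + N, CrossedDoubleLiteral N z i →
      (encodeReachability G s t)[i]? = some true) ↔
    ∃ (h1 : z / (N + N) < N + N) (h2 : z % (N + N) < N + N),
      (G.crossedDoubleFin s t).Adj ⟨z / (N + N), h1⟩ ⟨z % (N + N), h2⟩ := by
  have hN : 0 < N + N := Nat.pos_of_ne_zero (by intro h; rw [h] at hz; omega)
  have h1 : z / (N + N) < N + N := Nat.div_lt_of_lt_mul hz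
  have h2 : z % (N + N) < N + N := Nat.mod_lt _ hN
  simp only [h1, h2, exists_true_left, CrossedDoubleLiteral]
  generalize z / (N + N) = a at *
  generalize z % (N + N) = b at *
  have hl : ∀ x (hx : x < N) (h : x < N + N), finSumFinEquiv.symm (⟨x, h⟩ : Fin (N + N)) =
      Sum.inl ⟨x, hx⟩ := fun x hx h => finSumFinEquiv_symm_apply_castAdd (⟨x, hx⟩ : Fin N)
  have hr : ∀ x (hx : N ≤ x) (h : x < N + N), finSumFinEquiv.symm (⟨x, h⟩ : Fin (N + N)) =
      Sum.inr ⟨x - N, by omega⟩ := fun x hx h => by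
    rw [Equiv.symm_apply_eq, finSumFinEquiv_apply_right]
    ext; simp; omega
  have hadj (a b : ℕ) (ha : a < N) (hb : b < N) := encodeReachability_adj G s t ⟨a, ha⟩ ⟨b, hb⟩
  have hs (a : ℕ) (ha : a < N) := encodeReachability_source G s t ⟨a, ha⟩
  have ht (a : ℕ) (ha : a < N) := encodeReachability_target G s t ⟨a, ha⟩
  have hlt (a b : ℕ) (ha : a < N) (hb : b < N) := mul_add_lt_mul_self ha hb
  simp only [Digraph.crossedDoubleFin]
  -- The four blocks of the matrix: a diagonal entry copies one bit of `G`, an off-diagonal entry is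
  -- the conjunction of an indicator bit of `t` and one of `s`.
  rcases lt_or_ge a N with ha | ha <;> rcases lt_or_ge b N with hb | hb
  · rw [hl a ha, hl b hb]
    simp only [Digraph.crossedDouble, ← hadj a b ha hb]
    have := hlt a b ha hb
    constructor
    · exact fun H => H _ (by omega) (by omega)
    · intro H i hi h
      obtain rfl : i = a * N + b := by omega
      exact H
  · rw [hl a ha, hr b hb]
    simp only [Digraph.crossedDouble, ← ht a ha, ← hs (b - N) (by omega)]
    constructor
    · exact fun H => ⟨H _ (by omega) (by omega), H _ (by omega) (by omega)⟩
    · intro H i hi h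
      obtain rfl | rfl : i = N * N + N + a ∨ i = N * N + (b - N) := by omega
      · exact H.1
      · exact H.2
  · rw [hr a ha, hl b hb]
    simp only [Digraph.crossedDouble, ← ht (a - N) (by omega), ← hs b hb]
    constructor
    · exact fun H => ⟨H _ (by omega) (by omega), H _ (by omega) (by omega)⟩
    · intro H i hi h
      obtain rfl | rfl : i = N * N + N + (a - N) ∨ i = N * N + b := by omega
      · exact H.1
      · exact H.2
  · rw [hr a ha, hr b hb]
    simp only [Digraph.crossedDouble, ← hadj (a - N) (b - N) (by omega) (by omega)]
    have := hlt (a - N) (b - N) (by omega) (by omega)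
    constructor
    · exact fun H => H _ (by omega) (by omega)
    · intro H i hi h
      obtain rfl : i = (a - N) * N + (b - N) := by omega
      exact H

open Classical in
theorem exists_ac0Computable_crossedDouble :
    ∃ f : List Bool → List Bool, AC0Computable f ∧
      ∀ (N : ℕ) (G : Digraph (Fin N)) (s t : Fin N),
        f (encodeReachability G s t) = encodeDigraph (G.crossedDoubleFin s t) := by
  refine ⟨fun x => List.ofFn fun z : Fin ((x.length.sqrt + x.length.sqrt) *
    (x.length.sqrt + x.length.sqrt)) => decide (∀ i < x.length,
      CrossedDoubleLiteral x.length.sqrt z i → x[i]? = some true), ?_, fun N G s t => ?_⟩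
  · have hs : ∀ {k}, FOFun (k := k) fun n _ => n.sqrt := FOFun.length.sqrt
    refine AC0Computable.of_forall_literals (m := fun n => (n.sqrt + n.sqrt) * (n.sqrt + n.sqrt))
      (pos := fun n z i => CrossedDoubleLiteral n.sqrt z i) (neg := fun _ _ _ => False)
      ((hs.add hs).mul (hs.add hs)) (foDef_crossedDoubleLiteral hs (.var 0) (.var 1)) (.const False)
      (fun x => by simp) fun x z hz => by simp
  -- The number of vertices is recovered from the input length, as `N * N ≤ N * N + N + N < (N + 1)
  -- * (N + 1)`.
  · have hx : (encodeReachability G s t).length.sqrt = N := by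
      rw [length_encodeReachability, eq_comm, Nat.eq_sqrt]
      constructor <;> nlinarith
    refine List.ext_getElem (by simp [hx]) fun z hz hz' => ?_
    rw [Bool.eq_iff_iff, getElem_encodeDigraph, List.getElem_ofFn, decide_eq_true_eq]
    simp only [hx]
    rw [length_encodeReachability]
    exact forall_crossedDoubleLiteral G s t z (by simpa using hz')

/-! ### Inductive counting as a linear proof system -/

/-- `v` is reachable from `s` by a path with fewer than `i` edges. -/
def ReachIn (s : ℕ) (E : ℕ → ℕ → Prop) : ℕ → ℕ → Prop
  | 0, _ => False
  | i + 1, v => v = s ∨ ∃ u, ReachIn s E i u ∧ E u v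

/-- A conjunction of four statements about `ReachIn s E`, see `CountState.Valid`: a stored statement
of kind `k` with parameters `a₁, …, a₄`, and statements about the size of the sets, about lower bounds
for parts of the sets, and about a single member. -/
structure CountState where
  k : ℕ
  a₁ : ℕ
  a₂ : ℕ
  a₃ : ℕ
  a₄ : ℕ
  i : ℕ
  r : ℕ
  v : ℕ
  r' : ℕ
  sg : ℕ
  di : ℕ
  dv : ℕ
  du : ℕ
  dc : ℕ
  mj : ℕ
  mw : ℕ

namespace CountState

section

variable (P s t : ℕ) (E : ℕ → ℕ → Prop)

open Classical in
/-- The number of members of `ReachIn s E i` below `v`. -/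
noncomputable def cnt (i v : ℕ) : ℕ := Nat.count (ReachIn s E i) v

open Classical in
/-- The number of members of `ReachIn s E i` below `u` that have (`sg ≠ 0`) or do not have
(`sg = 0`) an edge to `v`. -/
noncomputable def cntAdj (sg i v u : ℕ) : ℕ :=
  Nat.count (fun y => ReachIn s E i y ∧ (E y v ↔ sg ≠ 0)) u

/-- The stored statement is true. -/
def ValidStored (p : CountState) : Prop :=
  (p.k = 0 ∧ cnt s E p.a₁ p.a₂ = p.a₃) ∨ (p.k = 1 ∧ ReachIn s E p.a₁ p.a₂) ∨
  (p.k = 2 ∧ p.a₄ ≤ cntAdj s E 0 p.a₁ p.a₂ p.a₃) ∨ (p.k = 3 ∧ p.a₄ ≤ cntAdj s E 1 p.a₁ p.a₂ p.a₃)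

/-- The statement about sizes is true. -/
def ValidSize (p : CountState) : Prop :=
  p.i < P ∧ cnt s E p.i P = p.r ∧ cnt s E (p.i + 1) p.v = p.r'

/-- The statement about lower bounds is true. -/
def ValidBound (p : CountState) : Prop :=
  p.dc ≤ cntAdj s E p.sg p.di p.dv p.du

/-- All statements of the state are true. -/
def Valid (p : CountState) : Prop :=
  ValidStored s E p ∧ ValidSize P s E p ∧ ValidBound s E p ∧ ReachIn s E p.mj p.mw

/-- The stored statement of `q` is that of `p`, or trivial, or another statement of `p`. -/
def StepStored (p q : CountState) : Prop :=
  (q.k = p.k ∧ q.a₁ = p.a₁ ∧ q.a₂ = p.a₂ ∧ q.a₃ = p.a₃ ∧ q.a₄ = p.a₄) ∨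
  (q.k = 0 ∧ q.a₁ = 0 ∧ q.a₃ = 0) ∨
  (q.k = 0 ∧ q.a₁ = p.i ∧ q.a₂ = P ∧ q.a₃ = p.r) ∨
  (q.k = 0 ∧ q.a₁ = p.i + 1 ∧ q.a₂ = p.v ∧ q.a₃ = p.r') ∨
  (q.k = 1 ∧ q.a₁ = p.mj ∧ q.a₂ = p.mw) ∨
  (((p.sg = 0 ∧ q.k = 2) ∨ (p.sg ≠ 0 ∧ q.k = 3)) ∧
    q.a₁ = p.di ∧ q.a₂ = p.dv ∧ q.a₃ = p.du ∧ q.a₄ = p.dc)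

/-- The statement of `q` about sizes is that of `p`, or trivial, or counts one more vertex. -/
def StepSize (p q : CountState) : Prop :=
  (q.i = p.i ∧ q.r = p.r ∧ q.v = p.v ∧ q.r' = p.r') ∨
  (q.i = 0 ∧ q.r = 0 ∧ q.v = 0 ∧ q.r' = 0) ∨
  (p.v < P ∧ q.i = p.i ∧ q.r = p.r ∧ q.v = p.v + 1 ∧ q.r' = p.r' + 1 ∧
    p.mj = p.i + 1 ∧ p.mw = p.v) ∨
  -- The vertex `p.v` may be skipped: it is not `s`, and as many members of level `p.i` as there are
  -- in all have no edge to it.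
  (p.v < P ∧ q.i = p.i ∧ q.r = p.r ∧ q.v = p.v + 1 ∧ q.r' = p.r' ∧
    p.v ≠ s ∧ p.sg = 0 ∧ p.di = p.i ∧ p.dv = p.v ∧ p.du = P ∧ p.dc = p.r) ∨
  (p.v = P ∧ p.i + 1 < P ∧ q.i = p.i + 1 ∧ q.r = p.r' ∧ q.v = 0 ∧ q.r' = 0)

/-- The statement of `q` about lower bounds is that of `p`, or trivial, or takes one more vertex into
account. -/
def StepBound (p q : CountState) : Prop :=
  (q.sg = p.sg ∧ q.di = p.di ∧ q.dv = p.dv ∧ q.du = p.du ∧ q.dc = p.dc) ∨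
  (q.du = 0 ∧ q.dc = 0) ∨
  (q.sg = p.sg ∧ q.di = p.di ∧ q.dv = p.dv ∧ q.du = p.du + 1 ∧ q.dc = p.dc) ∨
  (q.sg = p.sg ∧ q.di = p.di ∧ q.dv = p.dv ∧ q.du = p.du + 1 ∧ q.dc = p.dc + 1 ∧
    p.mj = p.di ∧ p.mw = p.du ∧ (E p.mw p.dv ↔ p.sg ≠ 0))

/-- The member of `q` is that of `p`, or `s`, or a successor of that of `p`. -/
def StepMember (p q : CountState) : Prop :=
  (q.mj = p.mj ∧ q.mw = p.mw) ∨ (1 ≤ q.mj ∧ q.mw = s) ∨ (q.mj = p.mj + 1 ∧ E p.mw q.mw)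

/-- The state is contradictory, provided that `t` is not reachable. -/
def Bot (p : CountState) : Prop :=
  4 ≤ p.k ∨ P ≤ p.i ∨ p.mw = t ∨
  (p.k = 0 ∧ ((p.a₁ = 0 ∧ p.a₃ ≠ 0) ∨ (p.a₁ = p.i + 1 ∧ p.a₂ = p.v ∧ p.a₃ ≠ p.r'))) ∨
  (p.k = 1 ∧ (p.a₁ = 0 ∨ (p.a₁ = p.i + 1 ∧ p.a₂ ≠ s ∧ p.sg = 0 ∧ p.di = p.i ∧ p.dv = p.a₂ ∧
    p.du = P ∧ p.dc = p.r))) ∨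
  -- Level `0` is empty, so a positive lower bound there is absurd. At higher levels, the members
  -- with and without an edge to the same vertex are claimed to number more than all members
  -- together.
  ((p.k = 2 ∨ p.k = 3) ∧ ((p.a₁ = 0 ∧ p.a₄ ≠ 0) ∨ (p.a₁ = p.i + 1 ∧ p.a₃ = p.v ∧ p.di = p.a₁ ∧
    p.dv = p.a₂ ∧ p.du = p.a₃ ∧ ((p.k = 2 ∧ p.sg ≠ 0) ∨ (p.k = 3 ∧ p.sg = 0)) ∧
    p.r' < p.a₄ + p.dc)))

/-- One inference; everything follows from a contradictory state. -/
def Edge (p q : CountState) : Prop :=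
  Bot P s t p ∨ (StepStored P p q ∧ StepSize P s p q ∧ StepBound E p q ∧ StepMember s E p q)

/-- All numbers of the state are at most `P`. -/
def Bounded (p : CountState) : Prop :=
  p.k ≤ P ∧ p.a₁ ≤ P ∧ p.a₂ ≤ P ∧ p.a₃ ≤ P ∧ p.a₄ ≤ P ∧ p.i ≤ P ∧ p.r ≤ P ∧ p.v ≤ P ∧ p.r' ≤ P ∧
  p.sg ≤ P ∧ p.di ≤ P ∧ p.dv ≤ P ∧ p.du ≤ P ∧ p.dc ≤ P ∧ p.mj ≤ P ∧ p.mw ≤ P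

/-- Derivability with bounded numbers. -/
def Derives : CountState → CountState → Prop :=
  Relation.ReflTransGen fun p q => Edge P s t E p q ∧ Bounded P q

end

section

variable {P s t : ℕ} {E : ℕ → ℕ → Prop}

theorem reachIn_lt (hs : s < P) (hE : ∀ u v, E u v → v < P) {i v : ℕ} (h : ReachIn s E i v) :
    v < P := by
  cases i with
  | zero => exact h.elim
  | succ i =>
    rcases h with rfl | ⟨u, -, h⟩
    · exact hs
    · exact hE u v h

theorem cnt_le (i v : ℕ) : cnt s E i v ≤ v := by
  classical exact Nat.count_le _

theorem cntAdj_le (sg i v u : ℕ) : cntAdj s E sg i v u ≤ u := by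
  classical exact Nat.count_le _

@[simp] theorem cnt_zero_left (v : ℕ) : cnt s E 0 v = 0 := by
  classical
  exact Nat.count_iff_forall_not.2 fun _ _ h => h

@[simp] theorem cnt_zero_right (i : ℕ) : cnt s E i 0 = 0 := by
  classical exact Nat.count_zero _

@[simp] theorem cntAdj_zero_left (sg v u : ℕ) : cntAdj s E sg 0 v u = 0 := by
  classical
  exact Nat.count_iff_forall_not.2 fun _ _ h => h.1

@[simp] theorem cntAdj_zero_right (sg i v : ℕ) : cntAdj s E sg i v 0 = 0 := by
  classical exact Nat.count_zero _

open Classical in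
theorem cnt_succ (i v : ℕ) : cnt s E i (v + 1) = cnt s E i v + if ReachIn s E i v then 1 else 0 :=
  Nat.count_succ _ _

open Classical in
theorem cntAdj_succ (sg i v u : ℕ) : cntAdj s E sg i v (u + 1) = cntAdj s E sg i v u +
    if ReachIn s E i u ∧ (E u v ↔ sg ≠ 0) then 1 else 0 :=
  Nat.count_succ _ _

theorem cnt_eq_add (i v u : ℕ) :
    cnt s E i u = cntAdj s E 0 i v u + cntAdj s E 1 i v u := by
  induction u with
  | zero => simp
  | succ u ih =>
    rw [cnt_succ, cntAdj_succ, cntAdj_succ, ih]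
    by_cases h1 : ReachIn s E i u <;> by_cases h2 : E u v <;> simp [h1, h2] <;> omega

theorem cntAdj_of_ne_zero {sg : ℕ} (h : sg ≠ 0) (i v u : ℕ) :
    cntAdj s E sg i v u = cntAdj s E 1 i v u := by
  unfold cntAdj
  congr! 4
  simp [h]

/-- The heart of inductive counting: nonmembership becomes a lower bound. If the members of level
`i` without an edge to `v` are as many as all members of level `i`, then none has an edge to `v`,
since by `cnt_eq_add` the two kinds add up to the total. -/
theorem not_reachIn_succ_iff (hs : s < P) (hE : ∀ u v, E u v → v < P) {i v : ℕ} :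
    ¬ ReachIn s E (i + 1) v ↔ v ≠ s ∧ cnt s E i P ≤ cntAdj s E 0 i v P := by
  classical
  have h : cnt s E i P ≤ cntAdj s E 0 i v P ↔ cntAdj s E 1 i v P = 0 := by
    rw [cnt_eq_add i v]; omega
  rw [h, cntAdj, Nat.count_iff_forall_not, ReachIn]
  push Not
  refine and_congr_right fun _ => forall_congr' fun u => ?_
  constructor
  · intro h _ h1; simp [h h1]
  · intro h h1; simpa using h (reachIn_lt hs hE h1) h1

theorem not_valid_of_bot (hs : s < P) (hE : ∀ u v, E u v → v < P) (ht : ∀ j, ¬ ReachIn s E j t)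
    {p : CountState} (hb : Bot P s t p) : ¬ Valid P s E p := by
  rintro ⟨h1, ⟨h2, h3, h4⟩, h5, h6⟩
  obtain ⟨k, a₁, a₂, a₃, a₄, i, r, v, r', sg, di, dv, du, dc, mj, mw⟩ := p
  simp only [ValidStored, ValidBound, Bot] at *
  rcases hb with h | h | rfl | ⟨rfl, ⟨rfl, h⟩ | ⟨rfl, rfl, h⟩⟩ |
    ⟨rfl, rfl | ⟨rfl, h, rfl, rfl, rfl, rfl, rfl⟩⟩ |
    ⟨hk, ⟨rfl, h⟩ | ⟨rfl, rfl, rfl, rfl, rfl, hsg, h⟩⟩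
  · omega
  · omega
  · exact ht _ h6
  · simp at h1; omega
  · simp at h1; omega
  · simp [ReachIn] at h1
  · simp at h1
    exact (not_reachIn_succ_iff hs hE).2 ⟨h, h3.trans_le h5⟩ h1
  · simp at h1; omega
  · rw [cnt_eq_add _ dv] at h4
    rcases hsg with ⟨rfl, hsg⟩ | ⟨rfl, rfl⟩
    · rw [cntAdj_of_ne_zero hsg] at h5
      simp at h1; omega
    · simp at h1; omega

/-- Inferences preserve truth if `t` is not reachable. -/
theorem Valid.of_edge (hs : s < P) (hE : ∀ u v, E u v → v < P) (ht : ∀ j, ¬ ReachIn s E j t)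
    {p q : CountState} (hp : Valid P s E p) (h : Edge P s t E p q) : Valid P s E q := by
  rcases h with hb | ⟨g1, g2, g3, g4⟩
  · exact absurd hp (not_valid_of_bot hs hE ht hb)
  obtain ⟨h1, ⟨h2, h3, h4⟩, h5, h6⟩ := hp
  obtain ⟨k, a₁, a₂, a₃, a₄, i, r, v, r', sg, di, dv, du, dc, mj, mw⟩ := p
  obtain ⟨k', a₁', a₂', a₃', a₄', i', ρ, v', ρ', sg', di', dv', du', dc', mj', mw'⟩ := q
  simp only [Valid, ValidSize, ValidStored, ValidBound, StepStored, StepSize, StepBound,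
    StepMember] at *
  refine ⟨?_, ?_, ?_, ?_⟩
  · rcases g1 with ⟨rfl, rfl, rfl, rfl, rfl⟩ | ⟨rfl, rfl, rfl⟩ | ⟨rfl, rfl, rfl, rfl⟩ |
      ⟨rfl, rfl, rfl, rfl⟩ | ⟨rfl, rfl, rfl⟩ | ⟨⟨rfl, rfl⟩ | ⟨hsg, rfl⟩, rfl, rfl, rfl, rfl⟩
    · exact h1
    · simp
    · simp [h3]
    · simp [h4]
    · simp [h6]
    · simp [h5]
    · rw [cntAdj_of_ne_zero hsg] at h5
      simp [h5]
  · rcases g2 with ⟨rfl, rfl, rfl, rfl⟩ | ⟨rfl, rfl, rfl, rfl⟩ | ⟨hv, rfl, rfl, rfl, rfl, rfl, rfl⟩ |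
      ⟨hv, rfl, rfl, rfl, rfl, hvs, rfl, rfl, rfl, rfl, rfl⟩ | ⟨rfl, hi, rfl, rfl, rfl, rfl⟩
    · exact ⟨h2, h3, h4⟩
    · simp; omega
    · exact ⟨h2, h3, by rw [cnt_succ, if_pos h6, h4]⟩
    · exact ⟨h2, h3, by rw [cnt_succ, if_neg ((not_reachIn_succ_iff hs hE).2 ⟨hvs, h3.trans_le h5⟩), h4, add_zero]⟩
    · exact ⟨hi, h4, by simp⟩
  · rcases g3 with ⟨rfl, rfl, rfl, rfl, rfl⟩ | ⟨rfl, rfl⟩ | ⟨rfl, rfl, rfl, rfl, rfl⟩ |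
      ⟨rfl, rfl, rfl, rfl, rfl, rfl, rfl, hE'⟩
    · exact h5
    · simp
    · rw [cntAdj_succ]; omega
    · rw [cntAdj_succ, if_pos ⟨h6, hE'⟩]; omega
  · rcases g4 with ⟨rfl, rfl⟩ | ⟨h, rfl⟩ | ⟨rfl, h⟩
    · exact h6
    · obtain ⟨j, rfl⟩ := Nat.exists_eq_add_of_le' h
      exact .inl rfl
    · exact .inr ⟨_, h6, h⟩

theorem Valid.of_derives (hs : s < P) (hE : ∀ u v, E u v → v < P) (ht : ∀ j, ¬ ReachIn s E j t)
    {p q : CountState} (hp : Valid P s E p) (h : Derives P s t E p q) : Valid P s E q := by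
  induction h with
  | refl => exact hp
  | tail _ h ih => exact ih.of_edge hs hE ht h.1

/-- A path from `s` is followed edge by edge in the membership component; all other components stay.
-/
theorem derives_member (hs : s < P) (hE : ∀ u v, E u v → v < P) {p : CountState}
    (hp : Bounded P p) {j w : ℕ} (hj : j ≤ P) (h : ReachIn s E j w) :
    Derives P s t E p { p with mj := j, mw := w } := by
  induction j generalizing w with
  | zero => exact h.elim
  | succ j ih =>
    have hw := reachIn_lt hs hE h
    have hb : Bounded P { p with mj := j + 1, mw := w } := by
      simp only [Bounded] at *; omega
    rcases h with rfl | ⟨u, hu, h⟩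
    · exact .single ⟨.inr ⟨.inl ⟨rfl, rfl, rfl, rfl, rfl⟩, .inl ⟨rfl, rfl, rfl, rfl⟩, .inl ⟨rfl, rfl, rfl, rfl, rfl⟩,
        .inr (.inl ⟨Nat.succ_pos j, rfl⟩)⟩, hb⟩
    · exact (ih (by omega) hu).tail ⟨.inr ⟨.inl ⟨rfl, rfl, rfl, rfl, rfl⟩, .inl ⟨rfl, rfl, rfl, rfl⟩, .inl ⟨rfl, rfl, rfl, rfl, rfl⟩,
        .inr (.inr ⟨rfl, h⟩)⟩, hb⟩

/-- The candidates are scanned in increasing order, and each one counted is first produced by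
`derives_member`. The member is reset to `s` at level `1` after every step, so the resulting state
does not depend on the path used. -/
theorem derives_bound (hs : s < P) (hE : ∀ u v, E u v → v < P) {p : CountState}
    (hp : Bounded P p) {sg i v u c : ℕ} (hsg : sg ≤ P) (hi : i ≤ P) (hv : v ≤ P) (hu : u ≤ P)
    (h : c ≤ cntAdj s E sg i v u) :
    Derives P s t E p { p with sg := sg, di := i, dv := v, du := u, dc := c, mj := 1, mw := s } := by
  have hb : ∀ u c, u ≤ P → c ≤ P →
      Bounded P { p with sg := sg, di := i, dv := v, du := u, dc := c, mj := 1, mw := s } := by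
    intro u c hu hc
    simp only [Bounded] at *; omega
  induction u generalizing c with
  | zero =>
    obtain rfl : c = 0 := by simpa using h
    exact .single ⟨.inr ⟨.inl ⟨rfl, rfl, rfl, rfl, rfl⟩, .inl ⟨rfl, rfl, rfl, rfl⟩, .inr (.inl ⟨rfl, rfl⟩),
      .inr (.inl ⟨le_rfl, rfl⟩)⟩, hb _ _ hu hu⟩
  | succ u ih =>
    have hc : c ≤ P := h.trans ((cntAdj_le _ _ _ _).trans hu)
    by_cases hcu : c ≤ cntAdj s E sg i v u
    · exact (ih (by omega) hcu).tail ⟨.inr ⟨.inl ⟨rfl, rfl, rfl, rfl, rfl⟩, .inl ⟨rfl, rfl, rfl, rfl⟩,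
        .inr (.inr (.inl ⟨rfl, rfl, rfl, rfl, rfl⟩)), .inr (.inl ⟨le_rfl, rfl⟩)⟩, hb _ _ hu hc⟩
    -- The bound is not met below `u`, so `u` itself has to be counted.
    · rw [cntAdj_succ] at h
      split_ifs at h with hm
      · obtain ⟨c, rfl⟩ : ∃ d, c = d + 1 := ⟨c - 1, by omega⟩
        have h1 := ih (c := c) (by omega) (by omega)
        have h2 := derives_member (t := t) hs hE (hb u c (by omega) (by omega)) hi hm.1
        exact (h1.trans h2).tail ⟨.inr ⟨.inl ⟨rfl, rfl, rfl, rfl, rfl⟩, .inl ⟨rfl, rfl, rfl, rfl⟩,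
          .inr (.inr (.inr ⟨rfl, rfl, rfl, rfl, rfl, rfl, rfl, hm.2⟩)),
          .inr (.inl ⟨le_rfl, rfl⟩)⟩, hb _ _ hu hc⟩
      · omega

/-- Inductive counting proper: the size of level `i` is known, and the members of level `i + 1` are
counted vertex by vertex. Members are exhibited by a path, nonmembers are certified by a lower bound
equal to the size of level `i`. -/
theorem derives_size (hs : s < P) (hE : ∀ u v, E u v → v < P) {p : CountState}
    (hp : Bounded P p) {i v : ℕ} (hi : i < P) (hv : v ≤ P) :
    Derives P s t E p { p with i := i, r := cnt s E i P, v := v, r' := cnt s E (i + 1) v, sg := 0,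
                               di := 0, dv := 0, du := 0, dc := 0, mj := 1, mw := s } := by
  let T (i v : ℕ) : CountState :=
    { p with i := i, r := cnt s E i P, v := v, r' := cnt s E (i + 1) v, sg := 0,
             di := 0, dv := 0, du := 0, dc := 0, mj := 1, mw := s }
  have hb : ∀ i v, i < P → v ≤ P → Bounded P (T i v) := by
    intro i v hi hv
    have h1 := cnt_le (s := s) (E := E) i P
    have h2 := cnt_le (s := s) (E := E) (i + 1) v
    simp only [Bounded, T] at *; omega
  have hv_step : ∀ i v, i < P → v < P → Derives P s t E (T i v) (T i (v + 1)) := by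
    intro i v hi hv
    have hb' := hb i (v + 1) hi hv
    by_cases hm : ReachIn s E (i + 1) v
    · have h1 := derives_member (t := t) hs hE (hb i v hi hv.le) (j := i + 1) hi hm
      refine h1.tail ⟨.inr ⟨.inl ⟨rfl, rfl, rfl, rfl, rfl⟩,
        .inr (.inr (.inl ⟨hv, rfl, rfl, rfl, ?_, rfl, rfl⟩)), .inr (.inl ⟨rfl, rfl⟩),
        .inr (.inl ⟨le_rfl, rfl⟩)⟩, hb'⟩
      simp [T, cnt_succ, hm]
    · obtain ⟨h0, h2⟩ := (not_reachIn_succ_iff hs hE).1 hm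
      have h1 := derives_bound (t := t) hs hE (hb i v hi hv.le) (Nat.zero_le P) hi.le hv.le le_rfl h2
      refine h1.tail ⟨.inr ⟨.inl ⟨rfl, rfl, rfl, rfl, rfl⟩,
        .inr (.inr (.inr (.inl ⟨hv, rfl, rfl, rfl, ?_, h0, rfl, rfl, rfl, rfl, rfl⟩))),
        .inr (.inl ⟨rfl, rfl⟩), .inr (.inl ⟨le_rfl, rfl⟩)⟩, hb'⟩
      simp [T, cnt_succ, hm]
  have hrow : ∀ i v, i < P → v ≤ P → Derives P s t E (T i 0) (T i v) := by
    intro i v hi hv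
    induction v with
    | zero => exact .refl
    | succ v ih => exact (ih (by omega)).trans (hv_step i v hi hv)
  suffices h : Derives P s t E p (T i 0) from h.trans (hrow i v hi hv)
  induction i with
  | zero =>
    refine .single ⟨.inr ⟨.inl ⟨rfl, rfl, rfl, rfl, rfl⟩, .inr (.inl ⟨rfl, ?_, rfl, ?_⟩),
      .inr (.inl ⟨rfl, rfl⟩), .inr (.inl ⟨le_rfl, rfl⟩)⟩, hb 0 0 hi (Nat.zero_le P)⟩ <;> simp [T]
  | succ i ih =>
    -- The completed count of level `i + 1` becomes the known size, and the count of the next level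
    -- starts at vertex `0`.
    refine ((ih (by omega)).trans (hrow i P (by omega) le_rfl)).tail ⟨.inr
      ⟨.inl ⟨rfl, rfl, rfl, rfl, rfl⟩, .inr (.inr (.inr (.inr ⟨rfl, hi, rfl, rfl, rfl, ?_⟩))),
      .inr (.inl ⟨rfl, rfl⟩), .inr (.inl ⟨le_rfl, rfl⟩)⟩, hb _ 0 hi (Nat.zero_le P)⟩
    simp [T]

theorem Bounded.of_derives {p q : CountState} (hp : Bounded P p) (h : Derives P s t E p q) :
    Bounded P q := by
  induction h with
  | refl => exact hp
  | tail _ h _ => exact h.2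

/-- Storing a statement. -/
theorem edge_stored {p : CountState} (k a₁ a₂ a₃ a₄ : ℕ)
    (h : StepStored P p { p with k := k, a₁ := a₁, a₂ := a₂, a₃ := a₃, a₄ := a₄ }) :
    Edge P s t E p { p with k := k, a₁ := a₁, a₂ := a₂, a₃ := a₃, a₄ := a₄ } :=
  .inr ⟨h, .inl ⟨rfl, rfl, rfl, rfl⟩, .inl ⟨rfl, rfl, rfl, rfl, rfl⟩, .inl ⟨rfl, rfl⟩⟩

/-- Every state derives a state with a given true stored statement. -/
theorem derives_stored (hs : s < P) (hE : ∀ u v, E u v → v < P) {p q : CountState}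
    (hp : Bounded P p) (hq : Bounded P q) (h : ValidStored s E q) :
    ∃ p', Bounded P p' ∧ Derives P s t E p p' ∧
      q.k = p'.k ∧ q.a₁ = p'.a₁ ∧ q.a₂ = p'.a₂ ∧ q.a₃ = p'.a₃ ∧ q.a₄ = p'.a₄ := by
  suffices H : ∃ p', Bounded P p' ∧ Derives P s t E p p' ∧
      StepStored P p' { p' with k := q.k, a₁ := q.a₁, a₂ := q.a₂, a₃ := q.a₃, a₄ := q.a₄ } by
    obtain ⟨p', hp', h1, h2⟩ := H
    have hb : Bounded P { p' with k := q.k, a₁ := q.a₁, a₂ := q.a₂, a₃ := q.a₃, a₄ := q.a₄ } := by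
      simp only [Bounded] at *; omega
    exact ⟨_, hb, h1.tail ⟨edge_stored _ _ _ _ _ h2, hb⟩, rfl, rfl, rfl, rfl, rfl⟩
  have hq' := id hq
  obtain ⟨-, ha₁, ha₂, ha₃, -⟩ := hq
  rcases h with ⟨hk, h⟩ | ⟨hk, h⟩ | ⟨hk, h⟩ | ⟨hk, h⟩
  -- Size states count a level `i + 1`; the empty level `0` has its own trivial stored statement.
  · rcases ha : q.a₁ with - | i
    · rw [ha, cnt_zero_left] at h
      exact ⟨p, hp, .refl, .inr (.inl ⟨hk, rfl, h.symm⟩)⟩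
    · have d := derives_size (t := t) hs hE hp (i := i) (v := q.a₂) (by omega) ha₂
      exact ⟨_, hp.of_derives d, d, .inr (.inr (.inr (.inl ⟨hk, rfl, rfl, by rw [← ha, h]⟩)))⟩
  · have d := derives_member (t := t) hs hE hp ha₁ h
    exact ⟨_, hp.of_derives d, d, .inr (.inr (.inr (.inr (.inl ⟨hk, rfl, rfl⟩))))⟩
  · have d := derives_bound (t := t) hs hE hp (Nat.zero_le P) ha₁ ha₂ ha₃ h
    exact ⟨_, hp.of_derives d, d, .inr (.inr (.inr (.inr (.inr
      ⟨.inl ⟨rfl, hk⟩, rfl, rfl, rfl, rfl⟩))))⟩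
  · have d := derives_bound (t := t) hs hE hp (by omega) ha₁ ha₂ ha₃ h
    exact ⟨_, hp.of_derives d, d, .inr (.inr (.inr (.inr (.inr
      ⟨.inr ⟨one_ne_zero, hk⟩, rfl, rfl, rfl, rfl⟩))))⟩

/-- Every state derives every true state. -/
theorem derives_of_valid (hs : s < P) (hE : ∀ u v, E u v → v < P) {p q : CountState}
    (hp : Bounded P p) (hq : Bounded P q) (h : Valid P s E q) : Derives P s t E p q := by
  obtain ⟨h1, ⟨h2, h3, h4⟩, h5, h6⟩ := h
  -- The order matters: deriving sizes resets the bound and the member, deriving a bound resets the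
  -- member, and none of them touches the stored statement.
  obtain ⟨p₁, hp₁, d₁, e₁, e₂, e₃, e₄, e₅⟩ :=
    derives_stored (t := t) hs hE hp hq h1
  obtain ⟨-, -, -, -, -, -, -, hv, -, hsg, hdi, hdv, hdu, -, hmj, -⟩ := id hq
  have d₂ := derives_size (t := t) hs hE hp₁ h2 hv
  rw [h3, h4] at d₂
  have d₃ := derives_bound (t := t) hs hE (hp₁.of_derives d₂) hsg hdi hdv hdu h5
  have d₄ := derives_member (t := t) hs hE ((hp₁.of_derives d₂).of_derives d₃) hmj h6
  have d := d₁.trans (d₂.trans (d₃.trans d₄))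
  dsimp only at d
  rw [← e₁, ← e₂, ← e₃, ← e₄, ← e₅] at d
  exact d

/-- The other components can be rebuilt while the false statement stays in storage. A false size is
confronted with the true size, a false membership with the certificate of nonmembership, and a false
lower bound with the exact number for the opposite sign together with the true total. At level `0`
the state is already contradictory. -/
theorem exists_derives_bot_of_not_validStored (hs : s < P) (hE : ∀ u v, E u v → v < P)
    {p : CountState} (hp : Bounded P p) (h : ¬ ValidStored s E p) :
    ∃ q, Derives P s t E p q ∧ Bot P s t q := by
  by_cases hk : 4 ≤ p.k
  · exact ⟨p, .refl, .inl hk⟩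
  obtain ⟨-, ha₁, ha₂, ha₃, -⟩ := id hp
  obtain ⟨g0, g1, g2, g3⟩ : (p.k = 0 → cnt s E p.a₁ p.a₂ ≠ p.a₃) ∧
      (p.k = 1 → ¬ ReachIn s E p.a₁ p.a₂) ∧ (p.k = 2 → cntAdj s E 0 p.a₁ p.a₂ p.a₃ < p.a₄) ∧
      (p.k = 3 → cntAdj s E 1 p.a₁ p.a₂ p.a₃ < p.a₄) := by
    simp only [ValidStored, not_or, not_and, not_le] at h; exact h
  have hk : p.k = 0 ∨ p.k = 1 ∨ p.k = 2 ∨ p.k = 3 := by omega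
  rcases ha : p.a₁ with - | i
  · rw [ha] at g0 g1 g2 g3
    simp only [cnt_zero_left, cntAdj_zero_left] at g0 g2 g3
    refine ⟨p, .refl, .inr (.inr (.inr ?_))⟩
    rcases hk with hk | hk | hk | hk
    · exact .inl ⟨hk, .inl ⟨ha, (g0 hk).symm⟩⟩
    · exact .inr (.inl ⟨hk, .inl ha⟩)
    · exact .inr (.inr ⟨.inl hk, .inl ⟨ha, (g2 hk).ne'⟩⟩)
    · exact .inr (.inr ⟨.inr hk, .inl ⟨ha, (g3 hk).ne'⟩⟩)
  · rw [ha] at g0 g1 g2 g3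
    rcases hk with hk | hk
    · have d := derives_size (t := t) hs hE hp (i := i) (v := p.a₂) (by omega) ha₂
      exact ⟨_, d, .inr (.inr (.inr (.inl ⟨hk, .inr ⟨ha, rfl, (g0 hk).symm⟩⟩)))⟩
    rcases hk with hk | hk
    · obtain ⟨hne, hle⟩ := (not_reachIn_succ_iff hs hE).1 (g1 hk)
      have d := derives_size (t := t) hs hE hp (i := i) (v := 0) (by omega) (Nat.zero_le P)
      have d' := derives_bound (t := t) hs hE (hp.of_derives d) (Nat.zero_le P) (by omega) ha₂
        le_rfl hle
      exact ⟨_, d.trans d', .inr (.inr (.inr (.inr (.inl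
        ⟨hk, .inr ⟨ha, hne, rfl, rfl, rfl, rfl, rfl⟩⟩))))⟩
    · have d := derives_size (t := t) hs hE hp (i := i) (v := p.a₃) (by omega) ha₃
      have hadd := cnt_eq_add (s := s) (E := E) (i + 1) p.a₂ p.a₃
      rcases hk with hk | hk
      · have d' := derives_bound (t := t) hs hE (hp.of_derives d) (sg := 1) (by omega) (ha ▸ ha₁) ha₂ ha₃
          le_rfl
        refine ⟨_, d.trans d', .inr (.inr (.inr (.inr (.inr
          ⟨.inl hk, .inr ⟨ha, rfl, ha.symm, rfl, rfl, .inl ⟨hk, one_ne_zero⟩, ?_⟩⟩))))⟩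
        have := g2 hk
        dsimp only
        omega
      · have d' := derives_bound (t := t) hs hE (hp.of_derives d) (sg := 0) (by omega) (ha ▸ ha₁) ha₂ ha₃
          le_rfl
        refine ⟨_, d.trans d', .inr (.inr (.inr (.inr (.inr
          ⟨.inr hk, .inr ⟨ha, rfl, ha.symm, rfl, rfl, .inr ⟨hk, rfl⟩, ?_⟩⟩))))⟩
        have := g3 hk
        dsimp only
        omega

/-- Every false state derives a contradictory state. -/
theorem exists_derives_bot (hs : s < P) (hE : ∀ u v, E u v → v < P) (hP : 3 ≤ P) {p : CountState}
    (hp : Bounded P p) (h : ¬ Valid P s E p) : ∃ q, Derives P s t E p q ∧ Bot P s t q := by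
  -- Any false component can be copied into storage and refuted there. The kinds go up to `3`,
  -- whence the assumption `3 ≤ P`.
  have key : ∀ k a₁ a₂ a₃ a₄,
      StepStored P p { p with k := k, a₁ := a₁, a₂ := a₂, a₃ := a₃, a₄ := a₄ } → k ≤ P → a₁ ≤ P →
      a₂ ≤ P → a₃ ≤ P → a₄ ≤ P →
      ¬ ValidStored s E { p with k := k, a₁ := a₁, a₂ := a₂, a₃ := a₃, a₄ := a₄ } →
      ∃ q, Derives P s t E p q ∧ Bot P s t q := by
    intro k a₁ a₂ a₃ a₄ hst h1 h2 h3 h4 h5 hv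
    have hb : Bounded P { p with k := k, a₁ := a₁, a₂ := a₂, a₃ := a₃, a₄ := a₄ } := by
      simp only [Bounded] at *; omega
    obtain ⟨q, hq, hq'⟩ := exists_derives_bot_of_not_validStored (t := t) hs hE hb hv
    exact ⟨q, .head ⟨edge_stored _ _ _ _ _ hst, hb⟩ hq, hq'⟩
  obtain ⟨-, -, -, -, -, -, hr, hv, hr', -, hdi, hdv, hdu, hdc, hmj, hmw⟩ := id hp
  by_cases hi : P ≤ p.i
  · exact ⟨p, .refl, .inr (.inl hi)⟩
  by_cases h1 : ValidStored s E p
  swap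
  · exact exists_derives_bot_of_not_validStored hs hE hp h1
  by_cases h2 : cnt s E p.i P = p.r
  swap
  · exact key 0 p.i P p.r 0 (.inr (.inr (.inl ⟨rfl, rfl, rfl, rfl⟩))) (by omega) (by omega)
      (by omega) (by omega) (by omega) (by simpa [ValidStored] using h2)
  by_cases h3 : cnt s E (p.i + 1) p.v = p.r'
  swap
  · exact key 0 (p.i + 1) p.v p.r' 0 (.inr (.inr (.inr (.inl ⟨rfl, rfl, rfl, rfl⟩)))) (by omega)
      (by omega) (by omega) (by omega) (by omega) (by simpa [ValidStored] using h3)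
  by_cases h4 : ReachIn s E p.mj p.mw
  swap
  · exact key 1 p.mj p.mw 0 0 (.inr (.inr (.inr (.inr (.inl ⟨rfl, rfl, rfl⟩))))) (by omega)
      (by omega) (by omega) (by omega) (by omega) (by simpa [ValidStored] using h4)
  have h5 : ¬ ValidBound s E p := fun h5 => h ⟨h1, ⟨by omega, h2, h3⟩, h5, h4⟩
  rw [ValidBound] at h5
  by_cases hsg : p.sg = 0
  · rw [hsg] at h5
    exact key 2 p.di p.dv p.du p.dc (.inr (.inr (.inr (.inr (.inr ⟨.inl ⟨hsg, rfl⟩, rfl, rfl, rfl,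
      rfl⟩))))) (by omega) hdi hdv hdu hdc (by simpa [ValidStored] using h5)
  · rw [cntAdj_of_ne_zero hsg] at h5
    exact key 3 p.di p.dv p.du p.dc (.inr (.inr (.inr (.inr (.inr ⟨.inr ⟨hsg, rfl⟩, rfl, rfl, rfl,
      rfl⟩))))) (by omega) hdi hdv hdu hdc (by simpa [ValidStored] using h5)

/-- If `t` is not reachable, derivability is implication of truth values. -/
theorem derives_iff (hs : s < P) (hE : ∀ u v, E u v → v < P) (hP : 3 ≤ P)
    (ht : ∀ j, ¬ ReachIn s E j t) {p q : CountState} (hp : Bounded P p) (hq : Bounded P q) :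
    Derives P s t E p q ↔ (Valid P s E p → Valid P s E q) := by
  refine ⟨fun h hv => hv.of_derives hs hE ht h, fun h => ?_⟩
  by_cases hv : Valid P s E p
  · exact derives_of_valid hs hE hp hq (h hv)
  · obtain ⟨b, hb, hb'⟩ := exists_derives_bot (t := t) hs hE hP hp hv
    exact hb.tail ⟨.inl hb', hq⟩

/-- The initial state. -/
def initial (s : ℕ) : CountState := ⟨0, 0, 0, 0, 0, 0, 0, 0, 0, 0, 0, 0, 0, 0, 1, s⟩

theorem bounded_initial (hs : s < P) : Bounded P (initial s) := by
  simp only [Bounded, initial]; omega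

theorem valid_initial (hs : s < P) : Valid P s E (initial s) :=
  ⟨.inl ⟨rfl, by simp [initial]⟩, ⟨by simp only [initial]; omega, by simp [initial],
    by simp [initial]⟩, Nat.zero_le _, .inl rfl⟩

/-- The true initial state is derivable from every state; from it the member is led along a path to
`t`, which is contradictory, so everything follows. -/
theorem derives_of_reachIn (hs : s < P) (hE : ∀ u v, E u v → v < P) {j : ℕ} (hj : j ≤ P)
    (ht : ReachIn s E j t) {p q : CountState} (hp : Bounded P p) (hq : Bounded P q) :
    Derives P s t E p q := by
  have h1 := derives_of_valid (t := t) hs hE hp (bounded_initial hs) (valid_initial hs)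
  have h2 := derives_member (t := t) hs hE (bounded_initial hs) hj ht
  exact (h1.trans h2).tail ⟨.inl (.inr (.inr (.inl rfl))), hq⟩

theorem exists_bounded_not_valid : ∃ p, Bounded P p ∧ ¬ Valid P s E p :=
  ⟨⟨0, 0, 0, 0, 0, 0, 0, 0, 0, 0, 0, 0, 0, 0, 0, 0⟩, by simp [Bounded], fun h => h.2.2.2⟩

theorem _root_.ReachIn.mono {i j v : ℕ} (hij : i ≤ j) (h : ReachIn s E i v) : ReachIn s E j v := by
  induction i generalizing j v with
  | zero => exact h.elim
  | succ i ih =>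
    obtain ⟨j, rfl⟩ : ∃ k, j = k + 1 := ⟨j - 1, by omega⟩
    exact h.imp_right fun ⟨u, hu, h⟩ => ⟨u, ih (by omega) hu, h⟩

theorem _root_.ReachIn.reflTransGen {j v : ℕ} (h : ReachIn s E j v) :
    Relation.ReflTransGen E s v := by
  induction j generalizing v with
  | zero => exact h.elim
  | succ j ih =>
    rcases h with rfl | ⟨u, hu, h⟩
    · exact .refl
    · exact (ih hu).tail h

/-- Reachability needs fewer than `P` edges. -/
theorem exists_reachIn_iff (hs : s < P) (hE : ∀ u v, E u v → v < P) {v : ℕ} :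
    Relation.ReflTransGen E s v ↔ ReachIn s E P v := by
  constructor
  · classical
    -- If no level up to `P` were stable, each would have a member more than the one before, and
    -- level `P + 1` would have more than `P` members below `P`.
    obtain ⟨i, hi, hstable⟩ : ∃ i ≤ P, ∀ v, ReachIn s E (i + 1) v → ReachIn s E i v := by
      by_contra! H
      have hc : ∀ i ≤ P + 1, i ≤ cnt s E i P := by
        intro i hi
        induction i with
        | zero => exact Nat.zero_le _
        | succ i ih =>
          obtain ⟨v, h1, h2⟩ := H i (by omega)
          refine (ih (by omega)).trans_lt ?_
          rw [cnt, cnt, Nat.count_eq_card_filter_range, Nat.count_eq_card_filter_range]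
          refine Finset.card_lt_card ⟨fun u hu => ?_, fun hsub => h2 ?_⟩
          · rw [Finset.mem_filter] at hu ⊢
            exact ⟨hu.1, hu.2.mono (Nat.le_succ i)⟩
          · have := hsub (Finset.mem_filter.2 ⟨Finset.mem_range.2 (reachIn_lt hs hE h1), h1⟩)
            exact (Finset.mem_filter.1 this).2
      have := hc (P + 1) le_rfl
      have := cnt_le (s := s) (E := E) (P + 1) P
      omega
    intro h
    refine ReachIn.mono hi ?_
    induction h with
    | refl => exact hstable _ (.inl rfl)
    | tail _ h ih => exact hstable _ (.inr ⟨_, ih, h⟩)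
  · exact ReachIn.reflTransGen

end

end CountState

namespace CountState

/-- The state whose numbers are the last sixteen digits of `a` in base `W`. -/
def decode (W a : ℕ) : CountState :=
  ⟨a / W ^ 0 % W, a / W ^ 1 % W, a / W ^ 2 % W, a / W ^ 3 % W, a / W ^ 4 % W, a / W ^ 5 % W,
    a / W ^ 6 % W, a / W ^ 7 % W, a / W ^ 8 % W, a / W ^ 9 % W, a / W ^ 10 % W, a / W ^ 11 % W,
    a / W ^ 12 % W, a / W ^ 13 % W, a / W ^ 14 % W, a / W ^ 15 % W⟩

theorem exists_digits {W m : ℕ} (f : Fin m → ℕ) (hf : ∀ i, f i < W) :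
    ∃ a < W ^ m, ∀ i : Fin m, a / W ^ (i : ℕ) % W = f i := by
  let a := finFunctionFinEquiv fun i => (⟨f i, hf i⟩ : Fin W)
  refine ⟨a, a.2, fun i => ?_⟩
  have h : finFunctionFinEquiv.symm a i = ⟨f i, hf i⟩ :=
    congrFun (finFunctionFinEquiv.symm_apply_apply _) i
  exact congrArg Fin.val h

theorem eq_of_digits {W m a b : ℕ} (ha : a < W ^ m) (hb : b < W ^ m)
    (h : ∀ i : Fin m, a / W ^ (i : ℕ) % W = b / W ^ (i : ℕ) % W) : a = b := by
  have : (⟨a, ha⟩ : Fin (W ^ m)) = ⟨b, hb⟩ :=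
    finFunctionFinEquiv.symm.injective (funext fun i => Fin.ext (h i))
  exact congrArg Fin.val this

theorem bounded_decode (P a : ℕ) : Bounded P (decode (P + 1) a) := by
  have h (x : ℕ) : x % (P + 1) ≤ P := Nat.lt_succ_iff.1 (Nat.mod_lt _ (Nat.succ_pos P))
  simp only [Bounded, decode, h, and_self]

theorem exists_decode_eq {P : ℕ} {q : CountState} (hq : Bounded P q) :
    ∃ a < (P + 1) ^ 16, decode (P + 1) a = q := by
  obtain ⟨k, a₁, a₂, a₃, a₄, i, r, v, r', sg, di, dv, du, dc, mj, mw⟩ := q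
  obtain ⟨a, ha, h⟩ := exists_digits (W := P + 1)
    ![k, a₁, a₂, a₃, a₄, i, r, v, r', sg, di, dv, du, dc, mj, mw] (by
      simp only [Bounded] at hq
      simp only [Fin.forall_fin_succ, Nat.lt_succ_iff]
      simpa using hq)
  refine ⟨a, ha, ?_⟩
  rw [decode, mk.injEq]
  exact ⟨h 0, h 1, h 2, h 3, h 4, h 5, h 6, h 7, h 8, h 9, h 10, h 11, h 12, h 13, h 14, h 15⟩

theorem decode_injective {W a b : ℕ} (ha : a < W ^ 16) (hb : b < W ^ 16)
    (h : decode W a = decode W b) : a = b := by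
  rw [decode, decode, mk.injEq] at h
  obtain ⟨h0, h1, h2, h3, h4, h5, h6, h7, h8, h9, h10, h11, h12, h13, h14, h15⟩ := h
  refine eq_of_digits ha hb fun i => ?_
  fin_cases i <;> assumption

/-- The digraph of the inferences between states, together with a chain of two more vertices. -/
def digraph (P s t : ℕ) (E : ℕ → ℕ → Prop) : Digraph (Fin ((P + 1) ^ 16 + 2)) where
  Adj a b := (a < (P + 1) ^ 16 ∧ b < (P + 1) ^ 16 ∧
    Edge P s t E (decode (P + 1) a) (decode (P + 1) b)) ∨
    (a.1 = (P + 1) ^ 16 ∧ b.1 = (P + 1) ^ 16 + 1)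

section

variable {P s t : ℕ} {E : ℕ → ℕ → Prop} {a b : Fin ((P + 1) ^ 16 + 2)}

/-- The first `(P + 1) ^ 16` vertices correspond bijectively to the bounded states, and no edge
leads from them to the two additional vertices. -/
theorem reaches_digraph_iff (ha : (a : ℕ) < (P + 1) ^ 16) :
    (digraph P s t E).Reaches a b ↔
      (b : ℕ) < (P + 1) ^ 16 ∧ Derives P s t E (decode (P + 1) a) (decode (P + 1) b) := by
  constructor
  · intro h
    induction h with
    | refl => exact ⟨ha, .refl⟩
    | tail _ h ih =>
      rcases h with ⟨-, h2, h3⟩ | ⟨h1, -⟩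
      · exact ⟨h2, ih.2.tail ⟨h3, bounded_decode _ _⟩⟩
      · exact absurd ih.1 (by omega)
  · rintro ⟨hb, h⟩
    generalize hq : decode (P + 1) (b : ℕ) = q at h
    induction h generalizing b with
    | refl =>
      obtain rfl : a = b := Fin.ext (decode_injective ha hb hq.symm)
      exact .refl
    | @tail q q' h h' ih =>
      have hbd : Bounded P q := (bounded_decode P a).of_derives h
      obtain ⟨c, hc, rfl⟩ := exists_decode_eq hbd
      refine (ih (b := ⟨c, by omega⟩) hc rfl).tail (.inl ⟨hc, hb, ?_⟩)
      rw [hq]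
      exact h'.1

theorem reaches_digraph_of_le (ha : (P + 1) ^ 16 ≤ (a : ℕ)) :
    (digraph P s t E).Reaches a b ↔ a ≤ b := by
  constructor
  · intro h
    induction h with
    | refl => exact le_rfl
    | @tail b c _ h ih =>
      rcases h with ⟨h1, -⟩ | ⟨h1, h2⟩
      · have : (a : ℕ) ≤ b := ih
        omega
      · rw [Fin.le_def]; omega
  · intro h
    rcases h.eq_or_lt with rfl | h
    · exact .refl
    · have hb := b.2
      rw [Fin.lt_def] at h
      exact .single (.inr ⟨by omega, by omega⟩)

/-- If derivability is the pullback of the order of a chain of `m` elements, then the poset of the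
digraph consists of this chain and a chain of two elements. -/
theorem nonempty_orderIso_digraph {m : ℕ} (ψ : CountState → Fin m)
    (hψ : ∀ p q, Bounded P p → Bounded P q → (Derives P s t E p q ↔ ψ p ≤ ψ q))
    (hsurj : ∀ i, ∃ p, Bounded P p ∧ ψ p = i) :
    Nonempty ((digraph P s t E).StrongComponents ≃o Σ i, Fin ((![m, 2] : Fin 2 → ℕ) i)) := by
  let φ : Fin ((P + 1) ^ 16 + 2) → Σ i, Fin ((![m, 2] : Fin 2 → ℕ) i) := fun a =>
    if h : (a : ℕ) < (P + 1) ^ 16 then ⟨0, ψ (decode (P + 1) a)⟩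
    else ⟨1, (⟨a - (P + 1) ^ 16, by omega⟩ : Fin 2)⟩
  have hφ0 : ∀ a : Fin _, (a : ℕ) < (P + 1) ^ 16 → φ a = ⟨0, ψ (decode (P + 1) a)⟩ := fun a h => dif_pos h
  have hφ1 : ∀ a : Fin _, (ha : ¬ (a : ℕ) < (P + 1) ^ 16) →
    φ a = ⟨1, (⟨a - (P + 1) ^ 16, by omega⟩ : Fin 2)⟩ := fun a h => dif_neg h
  have hle : ∀ x y : Fin 2, (⟨1, x⟩ : Σ i, Fin ((![m, 2] : Fin 2 → ℕ) i)) ≤ ⟨1, y⟩ ↔ x ≤ y :=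
    fun x y => Sigma.mk_le_mk_iff (α := fun i => Fin ((![m, 2] : Fin 2 → ℕ) i))
  refine Digraph.nonempty_orderIso_of_reaches _ φ ?_ fun a b => ?_
  · rintro ⟨i, x⟩
    fin_cases i
    · obtain ⟨p, hp, rfl⟩ := hsurj x
      obtain ⟨a, ha, rfl⟩ := exists_decode_eq hp
      exact ⟨⟨a, by omega⟩, hφ0 _ ha⟩
    · change Fin 2 at x
      refine ⟨⟨(P + 1) ^ 16 + x, by omega⟩, (hφ1 _ (by simp)).trans ?_⟩
      simp
  · by_cases ha : (a : ℕ) < (P + 1) ^ 16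
    · rw [reaches_digraph_iff ha, hφ0 a ha]
      by_cases hb : (b : ℕ) < (P + 1) ^ 16
      · rw [hφ0 b hb, hψ _ _ (bounded_decode _ _) (bounded_decode _ _)]
        simp only [hb, true_and]
        exact (Sigma.mk_le_mk_iff (α := fun i => Fin ((![m, 2] : Fin 2 → ℕ) i)) (i := 0)).symm
      · rw [hφ1 b hb]
        simp [hb, Sigma.le_def]
    · rw [reaches_digraph_of_le (not_lt.1 ha), hφ1 a ha]
      by_cases hb : (b : ℕ) < (P + 1) ^ 16
      · rw [hφ0 b hb]
        simp [Sigma.le_def]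
        omega
      · rw [hφ1 b hb]
        refine Iff.trans ?_ (hle _ _).symm
        rw [Fin.le_def, Fin.le_def]
        dsimp only
        omega

/-- The poset of the digraph is a union of two chains, whose lengths differ iff `t` is reachable. -/
theorem digraph_spec (hs : s < P) (hE : ∀ u v, E u v → v < P) (hP : 3 ≤ P) :
    IsNimPoset 2 (digraph P s t E).StrongComponents ∧
    (IsExistsGame (digraph P s t E).StrongComponents ↔ Relation.ReflTransGen E s t) := by
  classical
  by_cases ht : Relation.ReflTransGen E s t
  · obtain ⟨e⟩ := nonempty_orderIso_digraph (P := P) (s := s) (t := t) (E := E) (m := 1)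
      (fun _ => 0) (fun p q hp hq => by
        simpa using derives_of_reachIn hs hE le_rfl ((exists_reachIn_iff hs hE).1 ht) hp hq)
      (fun i => ⟨_, bounded_initial hs, Subsingleton.elim _ _⟩)
    exact ⟨⟨_, ⟨e⟩⟩, iff_of_true ((isExistsGame_congr e).2 isExistsGame_one_two) ht⟩
  · have ht' : ∀ j, ¬ ReachIn s E j t := fun j hj => ht (hj.reflTransGen)
    obtain ⟨e⟩ := nonempty_orderIso_digraph (P := P) (s := s) (t := t) (E := E) (m := 2)
      -- Truth values as a chain: false states reach true ones, hence lie below them.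
      (fun p => if Valid P s E p then 1 else 0) (fun p q hp hq => by
        rw [derives_iff hs hE hP ht' hp hq]
        by_cases h1 : Valid P s E p <;> by_cases h2 : Valid P s E q <;> simp [h1, h2])
      (fun i => by
        fin_cases i
        · obtain ⟨p, hp, hv⟩ := exists_bounded_not_valid (P := P) (s := s) (E := E)
          exact ⟨p, hp, if_neg hv⟩
        · exact ⟨_, bounded_initial hs, if_pos (valid_initial hs)⟩)
    exact ⟨⟨_, ⟨e⟩⟩, iff_of_false
      (fun h => not_isExistsGame_two_two ((isExistsGame_congr e).1 h)) ht⟩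

end

end CountState

/-! ### The configuration graph of a nondeterministic Turing machine -/

/-- The input bit in cell `h` of the input tape as a number, `0` at the end markers. -/
def inputBit (x : List Bool) (h : ℕ) : ℕ := if 1 ≤ h ∧ x[h - 1]? = some true then 1 else 0

/-- The symbol `σ` is in cell `h` of the input tape if the word has length `n` and the bit in this
cell is `b`. -/
def InputSymbol.Matches (n h b : ℕ) : InputSymbol → Prop
  | .leftEnd => h = 0
  | .bit β => 1 ≤ h ∧ h ≤ n ∧ b = β.toNat
  | .rightEnd => n < h

theorem matches_inputBit_iff (x : List Bool) (h : ℕ) (σ : InputSymbol) :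
    σ.Matches x.length h (inputBit x h) ↔ inputSymbol x h = σ := by
  rcases h with - | h
  · cases σ <;> simp [InputSymbol.Matches, inputSymbol]
  · rcases lt_or_ge h x.length with hl | hl
    · rw [inputBit, inputSymbol]
      simp only [Nat.add_sub_cancel, List.getElem?_eq_getElem hl]
      rcases σ with - | (_ | _) | - <;> cases hx : x[h] <;>
        simp [InputSymbol.Matches] <;> omega
    · rw [inputBit, inputSymbol]
      simp only [Nat.add_sub_cancel, List.getElem?_eq_none hl]
      rcases σ with - | (_ | _) | - <;>
        simp [InputSymbol.Matches] <;> omega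

namespace NTM

variable {Q Γ : Type} (M : NTM Q Γ) {g : ℕ} (eQ : Q → ℕ) (eΓ : Γ ≃ Fin g)

/-- The bit number `r` of the code of the symbol `a`; the blank symbol has code `0`. -/
def SymbolBit (a : Γ) (r : ℕ) : Prop := a ≠ M.blank ∧ (eΓ a : ℕ) = r

/-- The first four digits of `u` in base `w` describe the configuration `c`. -/
def Represents (w u : ℕ) (c : Config Q Γ) : Prop :=
  u / w ^ 0 % w = eQ c.state + 1 ∧ u / w ^ 1 % w = c.inPos ∧ u / w ^ 2 % w = c.workPos ∧
  ∀ l, (u / w ^ 3 % w).testBit l = true ↔ M.SymbolBit eΓ (c.work (l / g)) (l % g)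

/-- The edges of the configuration graph on numbers, for inputs of length `n`, provided that the
input bit under the head is `b`. Accepting configurations are joined to `0`. -/
def CodeStep (w n u v b : ℕ) : Prop :=
  (v = 0 ∧ ∃ q : M.accept, u / w ^ 0 % w = eQ q + 1) ∨
  ∃ q σ a q' a' m m', M.trans q σ a q' a' m m' ∧
    u / w ^ 0 % w = eQ q + 1 ∧ σ.Matches n (u / w ^ 1 % w) b ∧
    (∀ r : Fin g, (u / w ^ 3 % w).testBit (g * (u / w ^ 2 % w) + r) = true ↔ M.SymbolBit eΓ a r) ∧
    v / w ^ 0 % w = eQ q' + 1 ∧ v / w ^ 1 % w = min (m.apply (u / w ^ 1 % w)) (n + 1) ∧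
    v / w ^ 2 % w = m'.apply (u / w ^ 2 % w) ∧
    -- A digit is less than `w < 2 ^ w`, so it has no bits from position `w` on.
    ∀ l < w, ((v / w ^ 3 % w).testBit l = true ↔
      (l / g = u / w ^ 2 % w ∧ M.SymbolBit eΓ a' (l % g)) ∨
      (l / g ≠ u / w ^ 2 % w ∧ (u / w ^ 3 % w).testBit l = true))

/-- The configuration graph on input `x`. -/
def CodeEdge (w : ℕ) (x : List Bool) (u v : ℕ) : Prop :=
  u < w ^ 4 ∧ v < w ^ 4 ∧ M.CodeStep eQ eΓ w x.length u v (inputBit x (u / w ^ 1 % w))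

variable {M eQ eΓ}

/-- A nonblank symbol has exactly one bit set and the blank none. Blank cells thus cost nothing, and
an infinite tape becomes a finite number. -/
theorem symbolBit_injective {a b : Γ}
    (h : ∀ r : Fin g, M.SymbolBit eΓ a r ↔ M.SymbolBit eΓ b r) : a = b := by
  by_cases ha : a = M.blank
  · by_contra hb
    exact ((h (eΓ b)).2 ⟨fun h => hb (ha.trans h.symm), rfl⟩).1 ha
  · exact (eΓ.injective (Fin.ext ((h (eΓ a)).1 ⟨ha, rfl⟩).2)).symm

theorem inPos_le_of_reachable {x : List Bool} {c : Config Q Γ} (h : M.Reachable x c) :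
    c.inPos ≤ x.length + 1 := by
  rcases Relation.ReflTransGen.cases_tail h with rfl | ⟨d, -, _, _, _, _, -, rfl⟩
  · exact Nat.zero_le _
  · exact min_le_right _ _

/-- The head only ever writes to cells below `B`. -/
theorem work_of_reachable {x : List Bool} {B : ℕ} (hB : ∀ c, M.Reachable x c → c.workPos < B)
    {c : Config Q Γ} (h : M.Reachable x c) {j : ℕ} (hj : B ≤ j) : c.work j = M.blank := by
  induction h with
  | refl => rfl
  | @tail d e hd h ih =>
    obtain ⟨_, _, _, _, -, rfl⟩ := h
    have := hB d hd
    rw [← ih]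
    exact Function.update_of_ne (by omega) _ _

section

variable {w B : ℕ} {x : List Bool}

theorem exists_represents (hQ : ∀ q, eQ q + 1 < w) (hn : x.length + 1 < w) (hw : 2 ^ (g * B) ≤ w)
    (hB : ∀ c, M.Reachable x c → c.workPos < B) {c : Config Q Γ} (h : M.Reachable x c) :
    ∃ u < w ^ 4, M.Represents eQ eΓ w u c := by
  classical
  have hg : 0 < g := (eΓ M.blank).pos
  let T : ℕ := Nat.ofBits fun l : Fin (g * B) => decide (M.SymbolBit eΓ (c.work (l / g)) (l % g))
  have hT : ∀ l, T.testBit l = true ↔ M.SymbolBit eΓ (c.work (l / g)) (l % g) := by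
    intro l
    rcases lt_or_ge l (g * B) with hl | hl
    · rw [Nat.testBit_ofBits_lt _ _ hl, decide_eq_true_eq]
    · rw [Nat.testBit_ofBits_ge _ _ hl, work_of_reachable hB h ((Nat.le_div_iff_mul_le hg).2
        (by rwa [mul_comm]))]
      simp [SymbolBit]
  have hTw : T < w := (Nat.ofBits_lt_two_pow _).trans_le hw
  have hwp : c.workPos < w := by
    have h1 : g * B < 2 ^ (g * B) := Nat.lt_two_pow_self
    have h2 : B ≤ g * B := Nat.le_mul_of_pos_left B hg
    have := hB c h
    omega
  obtain ⟨u, hu, hd⟩ := CountState.exists_digits (W := w) ![eQ c.state + 1, c.inPos, c.workPos, T]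
    (by
      have := inPos_le_of_reachable h
      simp only [Fin.forall_fin_succ]
      simp [hQ, hTw, hwp]
      omega)
  refine ⟨u, hu, hd 0, hd 1, hd 2, fun l => ?_⟩
  rw [show u / w ^ 3 % w = T from hd 3, hT]

theorem Represents.codeEdge {u v : ℕ} {c c' : Config Q Γ} (hu : M.Represents eQ eΓ w u c)
    (hv : M.Represents eQ eΓ w v c') (hu' : u < w ^ 4) (hv' : v < w ^ 4) (h : M.Step x c c') :
    M.CodeEdge eQ eΓ w x u v := by
  have hg : 0 < g := (eΓ M.blank).pos
  obtain ⟨q', a', m, m', htr, rfl⟩ := h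
  obtain ⟨u0, u1, u2, u3⟩ := hu
  obtain ⟨v0, v1, v2, v3⟩ := hv
  refine ⟨hu', hv', .inr ⟨_, _, _, _, _, _, _, htr, u0, ?_, fun r => ?_, v0, ?_, ?_, fun l _ => ?_⟩⟩
  · rw [matches_inputBit_iff, u1]
  · rw [u3, u2, Nat.mul_add_div hg, Nat.div_eq_of_lt r.2, add_zero, Nat.mul_add_mod,
      Nat.mod_eq_of_lt r.2]
  · rw [v1, u1]
  · rw [v2, u2]
  · rw [v3, u3, u2]
    dsimp only
    by_cases hl : l / g = c.workPos
    · simp [hl]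
    · simp [hl]

theorem Represents.exists_step (heQ : Function.Injective eQ) (hn : x.length + 1 < w)
    (hw : 2 ^ (g * B) ≤ w) {u v : ℕ} {c : Config Q Γ} (hc : c.workPos < B)
    (hu : M.Represents eQ eΓ w u c) (h : M.CodeEdge eQ eΓ w x u v) :
    (v = 0 ∧ c.state ∈ M.accept) ∨ ∃ c', M.Step x c c' ∧ M.Represents eQ eΓ w v c' := by
  have hg : 0 < g := (eΓ M.blank).pos
  obtain ⟨u0, u1, u2, u3⟩ := hu
  obtain ⟨-, -, ⟨rfl, q, hq⟩ | ⟨q, σ, a, q', a', m, m', htr, hq, hσ, ha, v0, v1, v2, v3⟩⟩ := h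
  · left
    have : c.state = q := heQ (by omega)
    exact ⟨rfl, this ▸ q.2⟩
  · right
    obtain rfl : c.state = q := heQ (by omega)
    rw [matches_inputBit_iff, u1] at hσ
    have hac : c.work c.workPos = a := by
      refine symbolBit_injective (M := M) (eΓ := eΓ) fun r => ?_
      rw [← ha r, u3, u2, Nat.mul_add_div hg, Nat.div_eq_of_lt r.2, add_zero, Nat.mul_add_mod,
        Nat.mod_eq_of_lt r.2]
    refine ⟨_, ⟨q', a', m, m', by rw [hσ, hac]; exact htr, rfl⟩, v0, by rw [v1, u1],
      by rw [v2, u2], fun l => ?_⟩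
    have key : (l / g = u / w ^ 2 % w ∧ M.SymbolBit eΓ a' (l % g)) ∨
        (l / g ≠ u / w ^ 2 % w ∧ (u / w ^ 3 % w).testBit l = true) ↔
        M.SymbolBit eΓ (Function.update c.work c.workPos a' (l / g)) (l % g) := by
      rw [u2, u3]
      by_cases hl : l / g = c.workPos
      · simp [hl]
      · simp [hl]
    rcases lt_or_ge l w with hl | hl
    · rw [v3 l hl, key]
    · have hbit : ∀ y, (y % w).testBit l = false := fun y =>
        Nat.testBit_lt_two_pow (((Nat.mod_lt y (by omega)).trans_le hl).trans Nat.lt_two_pow_self)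
      rw [hbit, ← key, hbit]
      have h1 : g * B < 2 ^ (g * B) := Nat.lt_two_pow_self
      have h2 : l / g ≠ u / w ^ 2 % w := by
        rw [u2]
        have : B ≤ l / g := (Nat.le_div_iff_mul_le hg).2 (by rw [mul_comm]; omega)
        omega
      simp [h2]

/-- Acceptance is reachability in the configuration graph. -/
theorem accepts_iff (heQ : Function.Injective eQ) (hQ : ∀ q, eQ q + 1 < w)
    (hn : x.length + 1 < w) (hw : 2 ^ (g * B) ≤ w)
    (hB : ∀ c, M.Reachable x c → c.workPos < B) :
    M.Accepts x ↔ Relation.ReflTransGen (M.CodeEdge eQ eΓ w x) (eQ M.start + 1) 0 := by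
  -- Only the state digit of the initial configuration is nonzero: both heads are at cell `0`, and
  -- the blank tape has code `0`.
  have h0 : M.Represents eQ eΓ w (eQ M.start + 1) M.init := by
    have h1 := hQ M.start
    have h2 : ∀ i, (eQ M.start + 1) / w ^ (i + 1) = 0 := fun i =>
      Nat.div_eq_of_lt (h1.trans_le (Nat.le_self_pow (Nat.succ_ne_zero i) w))
    refine ⟨?_, ?_, ?_, fun l => ?_⟩
    · rw [pow_zero, Nat.div_one, Nat.mod_eq_of_lt h1]; rfl
    · rw [h2, Nat.zero_mod]; rfl
    · rw [h2, Nat.zero_mod]; rfl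
    · rw [h2, Nat.zero_mod]
      simp [init, SymbolBit]
  have hpos : 0 < w := by omega
  constructor
  · rintro ⟨c, hc, hacc⟩
    have key : ∃ u < w ^ 4, M.Represents eQ eΓ w u c ∧
        Relation.ReflTransGen (M.CodeEdge eQ eΓ w x) (eQ M.start + 1) u := by
      clear hacc
      induction hc with
      | refl => exact ⟨_, (hQ _).trans_le (Nat.le_self_pow (by norm_num) w), h0, .refl⟩
      | tail h hs ih =>
        obtain ⟨u, hu, hu', hr⟩ := ih
        obtain ⟨v, hv, hv'⟩ := exists_represents (eΓ := eΓ) hQ hn hw hB (h.tail hs)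
        exact ⟨v, hv, hv', hr.tail (hu'.codeEdge hv' hu hv hs)⟩
    obtain ⟨u, hu, hu', hr⟩ := key
    exact hr.tail ⟨hu, by positivity, .inl ⟨rfl, ⟨c.state, hacc⟩, hu'.1⟩⟩
  · have key : ∀ v, Relation.ReflTransGen (M.CodeEdge eQ eΓ w x) (eQ M.start + 1) v →
        (v = 0 ∧ M.Accepts x) ∨ ∃ c, M.Reachable x c ∧ M.Represents eQ eΓ w v c := by
      intro v h
      induction h with
      | refl => exact .inr ⟨_, .refl, h0⟩
      | tail _ h ih =>
        rcases ih with ⟨rfl, -⟩ | ⟨c, hc, hr⟩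
        -- No edge leaves `0`, whose state digit is `0`, whereas state digits of configurations are
        -- positive.
        · obtain ⟨-, -, ⟨-, q, hq⟩ | ⟨q, _, _, _, _, _, _, -, hq, -⟩⟩ := h <;> simp at hq
        · rcases hr.exists_step heQ hn hw (hB c hc) h with ⟨rfl, hacc⟩ | ⟨c', hs, hr'⟩
          · exact .inl ⟨rfl, c, hc, hacc⟩
          · exact .inr ⟨c', hc.tail hs, hr'⟩
    intro h
    rcases key 0 h with ⟨-, h⟩ | ⟨c, -, hr⟩
    · exact h
    · have := hr.1
      simp at this

end

end NTM

/-! ### Digraphs whose edges depend on one input bit -/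

/-- Membership in `question` speaks of some digraph with the given encoding; injectivity identifies
it with the one constructed. -/
theorem encodeDigraph_injective {N N' : ℕ} {G : Digraph (Fin N)} {G' : Digraph (Fin N')}
    (h : encodeDigraph G = encodeDigraph G') : ∃ e : N = N', e ▸ G = G' := by
  have hN : N = N' := by
    have := congrArg List.length h
    simpa [Nat.mul_self_inj] using this
  subst hN
  refine ⟨rfl, ?_⟩
  ext a b
  have hab : ∀ G : Digraph (Fin N), G.Adj a b ↔ (encodeDigraph G)[(a : ℕ) * N + b]? = some true := by
    intro G
    rw [← encodeReachability_adj G a a a b, encodeReachability, List.append_assoc,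
      List.getElem?_append_left (by simpa using mul_add_lt_mul_self a.2 b.2)]
  rw [hab, hab, h]

/-- The adjacency matrix of a definable digraph in which the edges that leave a vertex `a` depend on
a single input bit, that in cell `h n a`, is computable in `AC⁰`. -/
theorem AC0Computable.of_adj_inputBit {N : ℕ → ℕ} {h : ℕ → ℕ → ℕ} {A : ℕ → ℕ → ℕ → ℕ → Prop}
    (hN : ∀ {k}, FOFun (k := k) fun n _ => N n)
    (hh : ∀ {k} {f : ℕ → (Fin k → ℕ) → ℕ}, FOFun f → FOFun fun n v => h n (f n v))
    (hA : ∀ {k} {f f' : ℕ → (Fin k → ℕ) → ℕ} (b : ℕ), FOFun f → FOFun f' →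
      FODef fun n v => A n (f n v) (f' n v) b) :
    AC0Computable fun x => encodeDigraph (N := N x.length)
      ⟨fun a a' => A x.length a a' (inputBit x (h x.length a))⟩ := by
  have hd : ∀ {k}, FOFun (k := k + 1) fun n v => v 0 / N n := (FOFun.var 0).div hN
  have hm : ∀ {k}, FOFun (k := k + 1) fun n v => v 0 % N n := (FOFun.var 0).mod hN
  have hlit : ∀ b : ℕ, FODef (k := 2) fun n v =>
      h n (v 0 / N n) = v 1 + 1 ∧ A n (v 0 / N n) (v 0 % N n) b := fun b =>
    (FODef.eq (hh hd) ((FOFun.var 1).add .one)).and (hA b hd hm)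
  -- Cell `i + 1` holds the input bit `i`. An entry is true if the bit is `1` and allows the edge,
  -- or is `0` and allows the edge; at an end marker `inputBit` is `0` and the entry is a constant.
  refine AC0Computable.of_exists_literal (m := fun n => N n * N n)
    (pos := fun n z i => h n (z / N n) = i + 1 ∧ A n (z / N n) (z % N n) 1)
    (neg := fun n z i => h n (z / N n) = i + 1 ∧ A n (z / N n) (z % N n) 0)
    (top := fun n z => ¬ (1 ≤ h n (z / N n) ∧ h n (z / N n) ≤ n) ∧ A n (z / N n) (z % N n) 0)
    (hN.mul hN) (hlit 1) (hlit 0)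
    ((((FODef.le .one (hh hd)).and (FODef.le (hh hd) .length)).not).and (hA 0 hd hm))
    (fun x => by simp) fun x z hz => ?_
  rw [getElem_encodeDigraph]
  have hz' : z < N x.length * N x.length := by simpa using hz
  have hpos : 0 < N x.length := Nat.pos_of_ne_zero fun h => by simp [h] at hz'
  simp only [Nat.div_lt_of_lt_mul hz', Nat.mod_lt _ hpos, exists_true_left]
  generalize hH : h x.length (z / N x.length) = H
  by_cases hr : 1 ≤ H ∧ H ≤ x.length
  · obtain ⟨i, rfl⟩ : ∃ i, H = i + 1 := ⟨H - 1, by omega⟩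
    have hi : i < x.length := by omega
    have hx : x[i]? = some x[i] := List.getElem?_eq_getElem hi
    simp only [hr, and_self, not_true_eq_false, false_and, false_or, Nat.add_right_cancel_iff,
      inputBit, Nat.add_sub_cancel]
    cases hb : x[i] <;> rw [hb] at hx
    · simp only [hx, Option.some_inj, Bool.false_eq_true, and_false, if_false]
      constructor
      · exact fun h => .inr ⟨i, hi, ⟨rfl, h⟩, hx⟩
      · rintro (⟨j, -, ⟨rfl, -⟩, h⟩ | ⟨j, -, ⟨rfl, h⟩, -⟩)
        · simp [hx] at h
        · exact h
    · simp only [hx, and_true, if_true]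
      constructor
      · exact fun h => .inl ⟨i, hi, ⟨rfl, h⟩, hx⟩
      · rintro (⟨j, -, ⟨rfl, h⟩, -⟩ | ⟨j, -, ⟨rfl, -⟩, h⟩)
        · exact h
        · simp [hx] at h
  · have hbit : inputBit x H = 0 := by
      rw [inputBit, if_neg]
      rintro ⟨h1, h2⟩
      have := (List.getElem?_eq_some_iff.1 h2).1
      omega
    rw [hbit]
    constructor
    · exact fun h => .inl ⟨hr, h⟩
    · rintro (⟨-, h⟩ | ⟨i, hi, ⟨rfl, -⟩, -⟩ | ⟨i, hi, ⟨rfl, -⟩, -⟩)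
      · exact h
      · omega
      · omega

/-! ### Definability of the inferences between states -/

/-- All numbers of the state are given by definable functions. -/
structure FOState {k : ℕ} (p : ℕ → (Fin k → ℕ) → CountState) : Prop where
  k : FOFun fun n v => (p n v).k
  a₁ : FOFun fun n v => (p n v).a₁
  a₂ : FOFun fun n v => (p n v).a₂
  a₃ : FOFun fun n v => (p n v).a₃
  a₄ : FOFun fun n v => (p n v).a₄
  i : FOFun fun n v => (p n v).i
  r : FOFun fun n v => (p n v).r
  v : FOFun fun n v => (p n v).v
  r' : FOFun fun n v => (p n v).r'
  sg : FOFun fun n v => (p n v).sg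
  di : FOFun fun n v => (p n v).di
  dv : FOFun fun n v => (p n v).dv
  du : FOFun fun n v => (p n v).du
  dc : FOFun fun n v => (p n v).dc
  mj : FOFun fun n v => (p n v).mj
  mw : FOFun fun n v => (p n v).mw

theorem FOFun.digit {k : ℕ} {w f : ℕ → (Fin k → ℕ) → ℕ} (hw : FOFun w) (hf : FOFun f) (i : ℕ) :
    FOFun fun n v => f n v / w n v ^ i % w n v :=
  (hf.div (hw.pow i)).mod hw

namespace FOState

variable {k : ℕ}

theorem decode {W f : ℕ → (Fin k → ℕ) → ℕ} (hW : FOFun W) (hf : FOFun f) :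
    FOState fun n v => CountState.decode (W n v) (f n v) := by
  constructor <;> exact hW.digit hf _

variable {P s t : ℕ → (Fin k → ℕ) → ℕ} {E : ℕ → (Fin k → ℕ) → ℕ → ℕ → Prop}
  {p q : ℕ → (Fin k → ℕ) → CountState}

theorem stepStored (hP : FOFun P) (hp : FOState p) (hq : FOState q) :
    FODef fun n v => CountState.StepStored (P n v) (p n v) (q n v) := by
  have h0 := FOFun.zero (k := k)
  have h1 := FOFun.one (k := k)
  have h2 := FOFun.const (k := k) 2
  have h3 := FOFun.const (k := k) 3
  cases hp; cases hq
  unfold CountState.StepStored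
  -- The relation is a Boolean combination of equations between components and constants, taken
  -- apart connective by connective.
  repeat' first
    | assumption
    | apply FODef.ne
    | apply FODef.eq
    | apply FODef.and
    | apply FODef.or
    | apply FOFun.add

theorem stepSize (hP : FOFun P) (hs : FOFun s) (hp : FOState p) (hq : FOState q) :
    FODef fun n v => CountState.StepSize (P n v) (s n v) (p n v) (q n v) := by
  have h0 := FOFun.zero (k := k)
  have h1 := FOFun.one (k := k)
  cases hp; cases hq
  unfold CountState.StepSize
  repeat' first
    | assumption
    | apply FODef.lt
    | apply FODef.ne
    | apply FODef.eq
    | apply FODef.and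
    | apply FODef.or
    | apply FOFun.add

theorem stepBound (hp : FOState p) (hq : FOState q)
    (hE : FODef fun n v => E n v (p n v).mw (p n v).dv) :
    FODef fun n v => CountState.StepBound (E n v) (p n v) (q n v) := by
  have h0 := FOFun.zero (k := k)
  have h1 := FOFun.one (k := k)
  cases hp; cases hq
  unfold CountState.StepBound
  repeat' first
    | assumption
    | apply FODef.ne
    | apply FODef.eq
    | apply FODef.and
    | apply FODef.or
    | apply FODef.iff
    | apply FOFun.add

theorem stepMember (hs : FOFun s) (hp : FOState p) (hq : FOState q)
    (hE : FODef fun n v => E n v (p n v).mw (q n v).mw) :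
    FODef fun n v => CountState.StepMember (s n v) (E n v) (p n v) (q n v) := by
  have h1 := FOFun.one (k := k)
  cases hp; cases hq
  unfold CountState.StepMember
  repeat' first
    | assumption
    | apply FODef.le
    | apply FODef.eq
    | apply FODef.and
    | apply FODef.or
    | apply FOFun.add

theorem bot (hP : FOFun P) (hs : FOFun s) (ht : FOFun t) (hp : FOState p) :
    FODef fun n v => CountState.Bot (P n v) (s n v) (t n v) (p n v) := by
  have h0 := FOFun.zero (k := k)
  have h1 := FOFun.one (k := k)
  have h2 := FOFun.const (k := k) 2
  have h3 := FOFun.const (k := k) 3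
  have h4 := FOFun.const (k := k) 4
  cases hp
  unfold CountState.Bot
  repeat' first
    | assumption
    | apply FODef.lt
    | apply FODef.le
    | apply FODef.ne
    | apply FODef.eq
    | apply FODef.and
    | apply FODef.or
    | apply FOFun.add

theorem edge (hP : FOFun P) (hs : FOFun s) (ht : FOFun t) (hp : FOState p) (hq : FOState q)
    (hE : FODef fun n v => E n v (p n v).mw (p n v).dv)
    (hE' : FODef fun n v => E n v (p n v).mw (q n v).mw) :
    FODef fun n v => CountState.Edge (P n v) (s n v) (t n v) (E n v) (p n v) (q n v) :=
  (bot hP hs ht hp).or ((stepStored hP hp hq).and ((stepSize hP hs hp hq).and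
    ((stepBound hp hq hE).and (stepMember hs hp hq hE'))))

end FOState

/-- An inference consults `E` only at edges leaving `p.mw`. For the configuration graph these depend
on the single input bit under the head of that configuration. -/
theorem CountState.edge_congr {P s t : ℕ} {E E' : ℕ → ℕ → Prop} {p q : CountState}
    (h : ∀ v, E p.mw v ↔ E' p.mw v) : Edge P s t E p q ↔ Edge P s t E' p q := by
  simp only [Edge, StepBound, StepMember, h]

/-! ### Definability of the configuration graph -/

namespace NTM

variable {Q Γ : Type} {M : NTM Q Γ} {g : ℕ} {eQ : Q → ℕ} {eΓ : Γ ≃ Fin g} {k : ℕ}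

theorem foDef_symbolBit (a : Γ) {f : ℕ → (Fin k → ℕ) → ℕ} (hf : FOFun f) :
    FODef fun n v => M.SymbolBit eΓ a (f n v) :=
  (FODef.const _).and (FODef.eq (.const _) hf)

theorem _root_.InputSymbol.foDef_matches (σ : InputSymbol) {h b : ℕ → (Fin k → ℕ) → ℕ}
    (hh : FOFun h) (hb : FOFun b) : FODef fun n v => σ.Matches n (h n v) (b n v) := by
  rcases σ with - | β | -
  · exact FODef.eq hh .zero
  · exact (FODef.le .one hh).and ((FODef.le hh .length).and (FODef.eq hb (.const _)))
  · exact FODef.lt .length hh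

theorem _root_.HeadMove.foFun_apply (m : HeadMove) {f : ℕ → (Fin k → ℕ) → ℕ} (hf : FOFun f) :
    FOFun fun n v => m.apply (f n v) := by
  cases m
  · exact hf.sub .one
  · exact hf
  · exact hf.add .one

theorem _root_.FOFun.nat_min {f g : ℕ → (Fin k → ℕ) → ℕ} (hf : FOFun f) (hg : FOFun g) :
    FOFun fun n v => min (f n v) (g n v) := by
  have h : ∀ a b : ℕ, min a b = a - (a - b) := fun a b => by omega
  simp only [h]
  exact hf.sub (hf.sub hg)

instance : Finite HeadMove :=
  Finite.of_surjective (fun i : Fin 3 => ![HeadMove.left, .stay, .right] i) fun m => by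
    cases m
    exacts [⟨0, rfl⟩, ⟨1, rfl⟩, ⟨2, rfl⟩]

instance : Finite InputSymbol :=
  Finite.of_surjective
    (fun i : Fin 4 => ![InputSymbol.leftEnd, .bit true, .bit false, .rightEnd] i) fun m => by
    rcases m with - | (_ | _) | -
    exacts [⟨0, rfl⟩, ⟨2, rfl⟩, ⟨1, rfl⟩, ⟨3, rfl⟩]

/-- The machine is finite, so the quantifiers over states, symbols and moves are finite
disjunctions, and the transition relation contributes only constants. -/
theorem foDef_codeStep [Finite Q] [Finite Γ] {w f f' : ℕ → (Fin k → ℕ) → ℕ} (hw : FOFun w)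
    (hf : FOFun f) (hf' : FOFun f') (b : ℕ) :
    FODef fun n v => M.CodeStep eQ eΓ (w n v) n (f n v) (f' n v) b := by
  refine FODef.or ((FODef.eq hf' .zero).and (FODef.exists_finite fun q =>
    FODef.eq (hw.digit hf 0) (.const _))) ?_
  iterate 7 refine FODef.exists_finite fun _ => ?_
  refine (FODef.const _).and ((FODef.eq (hw.digit hf 0) (.const _)).and
    ((InputSymbol.foDef_matches _ (hw.digit hf 1) (.const b)).and (.and ?_
    ((FODef.eq (hw.digit hf' 0) (.const _)).and ((FODef.eq (hw.digit hf' 1)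
    ((HeadMove.foFun_apply _ (hw.digit hf 1)).nat_min (FOFun.length.add .one))).and
    ((FODef.eq (hw.digit hf' 2) (HeadMove.foFun_apply _ (hw.digit hf 2))).and ?_))))))
  · refine FODef.forall_finite fun r => (FODef.testBit (hw.digit hf 3)
      (((FOFun.const g).mul (hw.digit hf 2)).add (.const r))).iff (foDef_symbolBit _ (.const r))
  · have hl : FOFun fun (_ : ℕ) (v : Fin (k + 1) → ℕ) => v 0 := .var 0
    have hd := hl.div (FOFun.const g)
    have h2 := (hw.digit hf 2).weaken
    have h3 := (hw.digit hf 3).weaken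
    have h3' := (hw.digit hf' 3).weaken
    refine FODef.forall_lt hw ?_
    exact (FODef.testBit h3' hl).iff (((FODef.eq hd h2).and
      (foDef_symbolBit _ (hl.mod (FOFun.const g)))).or ((FODef.ne hd h2).and (FODef.testBit h3 hl)))

end NTM

/-! ### Hardness -/

open CountState in
theorem isNLHard_nimExplicitAR_two : IsNLHard (nimExplicitAR 2) := by
  rintro L ⟨Q, Γ, _, _, M, ⟨κ, hκ⟩, hL⟩
  obtain ⟨nQ, ⟨iQ⟩⟩ := Finite.exists_equiv_fin Q
  obtain ⟨g, ⟨eΓ⟩⟩ := Finite.exists_equiv_fin Γ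
  let eQ : Q → ℕ := fun q => iQ q
  have heQ : Function.Injective eQ := fun a b h => iQ.injective (Fin.ext h)
  -- the base of the codes of configurations
  obtain ⟨d, hd⟩ := (((((FOFun.const 2).mul (FOFun.length.add .one)).pow (g * κ)).add
    (FOFun.length.add (.const (nQ + 2))))).bdd (k := 0) 0
  have hd : ∀ n, (2 * (n + 1)) ^ (g * κ) + (n + (nQ + 2)) ≤ n ^ d + d := fun n =>
    hd n Fin.elim0 fun i => i.elim0
  let w : ℕ → ℕ := fun n => n ^ d + d
  let P : ℕ → ℕ := fun n => w n ^ 4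
  let s : ℕ := eQ M.start + 1
  have hw : ∀ {k}, FOFun (k := k) fun n _ => w n := (FOFun.length.pow d).add (.const d)
  have hP : ∀ {k}, FOFun (k := k) fun n _ => P n := hw.pow 4
  have hW : ∀ {k}, FOFun (k := k) fun n _ => P n + 1 := hP.add .one
  have hV : ∀ {k}, FOFun (k := k) fun n _ => (P n + 1) ^ 16 := hW.pow 16
  have hwQ : ∀ n q, eQ q + 1 < w n := fun n q => by
    have := (iQ q).2
    have := hd n
    change (iQ q : ℕ) + 1 < n ^ d + d
    omega
  have hwn : ∀ n, n + 1 < w n := fun n => by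
    have := hd n
    change n + 1 < n ^ d + d
    omega
  have hwB : ∀ n, 2 ^ (g * (κ * (Nat.log 2 n + 1))) ≤ w n := fun n => by
    have h1 : 2 ^ (Nat.log 2 n + 1) ≤ 2 * (n + 1) := by
      rw [pow_succ, mul_comm]
      refine Nat.mul_le_mul_left 2 ?_
      rcases Nat.eq_zero_or_pos n with rfl | hn
      · simp
      · exact (Nat.pow_log_le_self 2 hn.ne').trans (Nat.le_succ n)
    calc 2 ^ (g * (κ * (Nat.log 2 n + 1))) = (2 ^ (Nat.log 2 n + 1)) ^ (g * κ) := by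
          rw [← pow_mul]; ring_nf
      _ ≤ (2 * (n + 1)) ^ (g * κ) := Nat.pow_le_pow_left h1 _
      _ ≤ w n := (Nat.le_add_right _ _).trans (hd n)
  have hwP : ∀ n, w n ≤ P n := fun n => Nat.le_self_pow (by norm_num) _
  have hsP : ∀ n, s < P n := fun n => (hwQ n M.start).trans_le (hwP n)
  have hP3 : ∀ n, 3 ≤ P n := fun n => by
    have h1 := hwn n
    have h2 : 2 ^ 4 ≤ w n ^ 4 := Nat.pow_le_pow_left (by omega) 4
    change 3 ≤ w n ^ 4
    omega
  let E (x : List Bool) : ℕ → ℕ → Prop := M.CodeEdge eQ eΓ (w x.length) x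
  let f : List Bool → List Bool := fun x => encodeDigraph (digraph (P x.length) s 0 (E x))
  have hspec := fun x => digraph_spec (P := P x.length) (s := s) (t := 0) (E := E x)
    (hsP _) (fun u v h => h.2.1) (hP3 _)
  refine ⟨f, ?_, fun x => ⟨⟨_, _, rfl, (hspec x).1⟩, ?_⟩⟩
  · let E' (n b : ℕ) : ℕ → ℕ → Prop := fun u v =>
      u < P n ∧ v < P n ∧ M.CodeStep eQ eΓ (w n) n u v b
    let A : ℕ → ℕ → ℕ → ℕ → Prop := fun n a a' b => (a < (P n + 1) ^ 16 ∧ a' < (P n + 1) ^ 16 ∧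
      Edge (P n) s 0 (E' n b) (decode (P n + 1) a) (decode (P n + 1) a')) ∨
      (a = (P n + 1) ^ 16 ∧ a' = (P n + 1) ^ 16 + 1)
    -- The input bit is made explicit: its cell is digit `1`, the input head position, of the
    -- configuration `mw` of the source state.
    have hf : f = fun x => encodeDigraph (N := (P x.length + 1) ^ 16 + 2)
        ⟨fun a a' => A x.length a a' (inputBit x
          ((decode (P x.length + 1) a).mw / w x.length ^ 1 % w x.length))⟩ := by
      funext x
      refine congrArg encodeDigraph ?_
      ext a a'
      refine or_congr (and_congr_right fun _ => and_congr_right fun _ => ?_) Iff.rfl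
      exact edge_congr fun v => Iff.rfl
    rw [hf]
    refine AC0Computable.of_adj_inputBit (N := fun n => (P n + 1) ^ 16 + 2)
      (h := fun n a => (decode (P n + 1) a).mw / w n ^ 1 % w n) (A := A) (hV.add (.const 2))
      (fun hf => hw.digit (FOState.decode hW hf).mw 1) fun b hf hf' => ?_
    have hE : ∀ {k} {u v : ℕ → (Fin k → ℕ) → ℕ}, FOFun u → FOFun v →
        FODef fun n y => E' n b (u n y) (v n y) := fun hu hv =>
      (FODef.lt hu hP).and ((FODef.lt hv hP).and (NTM.foDef_codeStep hw hu hv b))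
    have hp := FOState.decode hW hf
    have hp' := FOState.decode hW hf'
    exact ((FODef.lt hf hV).and ((FODef.lt hf' hV).and (FOState.edge hP (.const s) .zero hp hp'
      (hE hp.mw hp.dv) (hE hp.mw hp'.mw)))).or
      ((FODef.eq hf hV).and (FODef.eq hf' (hV.add .one)))
  · rw [hL, NTM.accepts_iff (eΓ := eΓ) heQ (hwQ x.length) (hwn x.length) (hwB x.length) (hκ x),
      ← (hspec x).2]
    constructor
    · exact fun h => ⟨_, _, rfl, h⟩
    · rintro ⟨N, G, hG, h⟩
      obtain ⟨rfl, rfl⟩ := encodeDigraph_injective hG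
      exact h

theorem mainTheorem8 :
    IsNLHard (nimExplicitAR 2) ∧
    (∀ (V : Type*) [Finite V] (G : Digraph V) (s t : V),
      IsExistsGame (G.crossedDouble s t).StrongComponents ↔ G.Reaches s t) ∧
    (∃ f : List Bool → List Bool, AC0Computable f ∧
      ∀ (N : ℕ) (G : Digraph (Fin N)) (s t : Fin N),
        f (encodeReachability G s t) = encodeDigraph (G.crossedDoubleFin s t)) :=
  ⟨isNLHard_nimExplicitAR_two, fun _ _ G s t => G.isExistsGame_crossedDouble s t,
    exists_ac0Computable_crossedDouble⟩
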